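/- **Proposition (Convergence in mean square).** Let $n\ge 1$, let $X\subset\mathbb R^n$, let $(\Omega,\mathcal F,\mathbb P)$ be a probability space, $\xi:\Omega\to\mathbb R^d$ a random vector, $\Phi:\mathbb R^n\times\mathbb R^d\to\mathbb R^n$ a (jointly) measurable map and $F(x)=\mathbb E[\Phi(x,\xi)]$. Norms are Euclidean. For $\epsilon\in\mathbb R$ put $X^{\epsilon}=X+\{u:\|u\|\le\epsilon\}$, and let $X^*=\{x\in X: F(x)^T(y-x)\ge 0\ \ \forall y\in X\}$ be the solution set of VI$(X,F)$. Assume: 1. (a) $X$ is closed, bounded and convex; (b) $F$ is monotone and continuous on $X^\epsilon$; (c) for some $C>0$, $\mathbb E[\|\Phi(x,\xi)\|^2]\le C^2$ for all $x\in X^\epsilon$; (d) $X^*\ne\emptyset$. 2. $\xi_0,\xi_1,\dots$ are independent copies of $\xi$; $z_0,z_1,\dots$ are independent, $z_k$ being uniformly distributed in the ball of radius $\epsilon_k$ centered at the origin of $\mathbb R^n$; the sequences $(\xi_j)_j$ and $(z_i)_i$ are independent of each other; $x_0$ is an $X$-valued random vector independent of the pair $\big((\xi_j)_j,(z_i)_i\big)$.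 3. (a) $\{\gamma_k\},\{\eta_k\},\{\epsilon_k\}$ $(k\ge0)$ are positive sequences converging to zero; (b) there is $K_1\ge 0$ with $\frac{\gamma_k}{\eta_k\epsilon_k^2}\le \frac12\left(\frac{(n-1)!!}{n!!\,\kappa C}\right)^2$ for all $k\ge K_1$, where $\kappa=1$ if $n$ is odd and $\kappa=2/\pi$ otherwise; (c) $\epsilon_k\le\epsilon$ for all $k\ge0$. 4. (a) There are $0<\delta<\frac12$ and $K_3\ge0$ with $\frac{\gamma_k}{\eta_k\epsilon_k^2}\le\frac{\gamma_{k+1}}{\eta_{k+1}\epsilon_{k+1}^2}(1+\delta\eta_{k+1}\gamma_{k+1})$ for all $k\ge K_3$; (b) there is $B_1>0$ with $\frac{\epsilon_k^2}{\eta_{k-1}^2\eta_k\gamma_k^3}\left(1-\frac{\min\{\epsilon_k,\epsilon_{k-1}\}}{\max\{\epsilon_k,\epsilon_{k-1}\}}\right)^2\le B_1$ for all $k\ge1$; (c) there is $B_2>0$ with $\frac{\epsilon_k^2}{\eta_k\gamma_k^3}\left(1-\frac{\eta_k}{\eta_{k-1}}\right)^2\le B_2$ for all $k\ge1$. Assume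 also that $\lim_{k\to\infty}\gamma_k/(\eta_k\epsilon_k^2)=0$, and let $\{x_k\}$ be generated by the regularized smoothed stochastic approximation (RSSA) scheme $$x_{k+1}=\Pi_X\big(x_k-\gamma_k(\Phi(x_k+z_k,\xi_k)+\eta_kx_k)\big),\qquad k\ge0,$$ where $\Pi_X$ is the Euclidean projection on $X$. Then: (a) $\lim_{k\to\infty}\mathbb E[\mathrm{dist}^2(x_k,X^*)]=0$ (the expectations being finite). (b) If in addition $\lim_{k\to\infty}\epsilon_k/\eta_k=0$ and $F$ is differentiable with bounded Jacobian in a neighborhood of $t^*$, where $t^*$ is the least-norm element of $X^*$, then $\lim_{k\to\infty}\mathbb E[\|x_k-t^*\|^2]=0$ (the expectations being finite). -/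

import Mathlib

open MeasureTheory ProbabilityTheory Filter Topology
open scoped Pointwise Nat RealInnerProductSpace

noncomputable section

/-- Euclidean space `ℝⁿ` with the Euclidean norm. -/
abbrev Vec (n : ℕ) : Type := EuclideanSpace ℝ (Fin n)

namespace RSSA

/-- `p` is the Euclidean projection of `v` on `X`. -/
def IsProjection {n : ℕ} (X : Set (Vec n)) (v p : Vec n) : Prop :=
  p ∈ X ∧ ∀ y ∈ X, ‖v - p‖ ≤ ‖v - y‖

/-- The enlargement `X + B(0, ρ)` by the closed ball of radius `ρ`. -/
def enlargement {n : ℕ} (X : Set (Vec n)) (ρ : ℝ) : Set (Vec n) :=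
  X + Metric.closedBall (0 : Vec n) ρ

/-- Solution set `SOL(X, F)` of the variational inequality `VI(X, F)`. -/
def SOL {n : ℕ} (X : Set (Vec n)) (F : Vec n → Vec n) : Set (Vec n) :=
  {x | x ∈ X ∧ ∀ y ∈ X, 0 ≤ ⟪F x, y - x⟫}

/-- `t` is a least-norm element of `SOL(X, F)`. -/
def IsLeastNormSolution {n : ℕ} (X : Set (Vec n)) (F : Vec n → Vec n) (t : Vec n) : Prop :=
  t ∈ SOL X F ∧ ∀ y ∈ SOL X F, ‖t‖ ≤ ‖y‖

/-- `F` is monotone over the set `S`. -/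
def MonotoneOver {n : ℕ} (F : Vec n → Vec n) (S : Set (Vec n)) : Prop :=
  ∀ x ∈ S, ∀ y ∈ S, 0 ≤ ⟪F x - F y, x - y⟫

/-- The expected-value mapping `F(x) = E[Φ(x, ξ)]`. -/
def expMap {n d : ℕ} {Ω : Type*} [MeasurableSpace Ω] (P : Measure Ω)
    (Φ : Vec n → Vec d → Vec n) (ξ : Ω → Vec d) (x : Vec n) : Vec n :=
  ∫ ω, Φ x (ξ ω) ∂P

/-- Properties of the problem: the set `X`, the mapping `F = E[Φ(·, ξ)]`, and the solution set.
`ρ` is the radius of the enlargement of `X` and `C` the second-moment bound. -/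
structure ProblemProperties {n d : ℕ} {Ω : Type*} [MeasurableSpace Ω] (P : Measure Ω)
    (X : Set (Vec n)) (Φ : Vec n → Vec d → Vec n) (ξ : Ω → Vec d) (ρ C : ℝ) : Prop where
  isClosed : IsClosed X
  isBounded : Bornology.IsBounded X
  convex : Convex ℝ X
  monotone : MonotoneOver (expMap P Φ ξ) (enlargement X ρ)
  continuous : ContinuousOn (expMap P Φ ξ) (enlargement X ρ)
  C_pos : 0 < C
  secondMoment : ∀ x ∈ enlargement X ρ,
    Integrable (fun ω => ‖Φ x (ξ ω)‖ ^ 2) P ∧ ∫ ω, ‖Φ x (ξ ω)‖ ^ 2 ∂P ≤ C ^ 2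
  solution : (SOL X (expMap P Φ ξ)).Nonempty

/-- Properties of the random inputs: the samples `ξs j` are i.i.d. copies of `ξ`, the `z i` are
independent and uniform on the closed balls of radius `ε i` centered at the origin, the samples
are independent of the smoothing variables, and the initial point `x₀` is independent of both. -/
structure RandomInputs {n d : ℕ} {Ω : Type*} [MeasurableSpace Ω] (P : Measure Ω)
    (ξ : Ω → Vec d) (ξs : ℕ → Ω → Vec d) (z : ℕ → Ω → Vec n) (x₀ : Ω → Vec n)
    (ε : ℕ → ℝ) : Prop where
  measurable_ξ : Measurable ξ
  measurable_ξs : ∀ j, Measurable (ξs j)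
  measurable_z : ∀ i, Measurable (z i)
  measurable_x₀ : Measurable x₀
  identDistrib_ξs : ∀ j, IdentDistrib (ξs j) ξ P P
  indep_ξs : iIndepFun ξs P
  indep_z : iIndepFun z P
  uniform_z : ∀ i, pdf.IsUniform (z i) (Metric.closedBall (0 : Vec n) (ε i)) P volume
  indep_ξs_z : IndepFun (fun ω j => ξs j ω) (fun ω i => z i ω) P
  indep_x₀ : IndepFun x₀ (fun ω => ((fun j => ξs j ω), (fun i => z i ω))) P

/-- `κ = 1` if `n` is odd and `κ = 2 / π` otherwise. -/
def kappa (n : ℕ) : ℝ := if Odd n then 1 else 2 / Real.pi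

/-- Conditions on the stepsize `γ`, regularization `η` and smoothing `ε` sequences. -/
structure TuningSequences (n : ℕ) (C ρ : ℝ) (γ η ε : ℕ → ℝ) : Prop where
  γ_pos : ∀ k, 0 < γ k
  η_pos : ∀ k, 0 < η k
  ε_pos : ∀ k, 0 < ε k
  γ_tendsto : Tendsto γ atTop (𝓝 0)
  η_tendsto : Tendsto η atTop (𝓝 0)
  ε_tendsto : Tendsto ε atTop (𝓝 0)
  ratio_le : ∃ K₁ : ℕ, ∀ k ≥ K₁, γ k / (η k * ε k ^ 2) ≤
    (1 / 2 : ℝ) * (((n - 1)‼ : ℝ) / ((n‼ : ℝ) * kappa n * C)) ^ 2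
  ε_le : ∀ k, ε k ≤ ρ

/-- Additional conditions on the sequences, used for mean-square convergence. In the last two,
the current index is `k + 1` and the preceding one is `k`. -/
structure MeanSquareSequences (γ η ε : ℕ → ℝ) : Prop where
  growth : ∃ δ : ℝ, 0 < δ ∧ δ < 1 / 2 ∧ ∃ K₃ : ℕ, ∀ k ≥ K₃,
    γ k / (η k * ε k ^ 2) ≤
      γ (k + 1) / (η (k + 1) * ε (k + 1) ^ 2) * (1 + δ * η (k + 1) * γ (k + 1))
  ε_variation : ∃ B₁ : ℝ, 0 < B₁ ∧ ∀ k,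
    ε (k + 1) ^ 2 / (η k ^ 2 * η (k + 1) * γ (k + 1) ^ 3) *
      (1 - min (ε (k + 1)) (ε k) / max (ε (k + 1)) (ε k)) ^ 2 ≤ B₁
  η_variation : ∃ B₂ : ℝ, 0 < B₂ ∧ ∀ k,
    ε (k + 1) ^ 2 / (η (k + 1) * γ (k + 1) ^ 3) * (1 - η (k + 1) / η k) ^ 2 ≤ B₂

/-- `x` is the sequence of RSSA iterates: `x 0` takes values in `X`, and
`x (k+1) = Π_X (x k - γ k (Φ (x k + z k, ξs k) + η k x k))`. -/
structure IsRSSA {n d : ℕ} {Ω : Type*} (X : Set (Vec n)) (Φ : Vec n → Vec d → Vec n)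
    (γ η : ℕ → ℝ) (ξs : ℕ → Ω → Vec d) (z : ℕ → Ω → Vec n) (x : ℕ → Ω → Vec n) : Prop where
  init : ∀ ω, x 0 ω ∈ X
  step : ∀ k ω, IsProjection X
    (x k ω - γ k • (Φ (x k ω + z k ω) (ξs k ω) + η k • x k ω)) (x (k + 1) ω)

/-- The Jacobian of `F` exists and is bounded in a neighborhood of `t`. -/
def BoundedJacobianNear {n : ℕ} (F : Vec n → Vec n) (t : Vec n) : Prop :=
  ∃ r > (0 : ℝ), ∃ J : ℝ, ∀ x ∈ Metric.ball t r, DifferentiableAt ℝ F x ∧ ‖fderiv ℝ F x‖ ≤ J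

end RSSA

end

/-! Let F_k be the average of F over balls of radius ε_k, and s_k the solution of VI(X, F_k +
η_k·id), which exists because this map is Lipschitz and η_k-strongly monotone. As x_k is independent
of (z_k, ξ_k), the sample Φ(x_k + z_k, ξ_k) has conditional mean F_k(x_k). So each step is a noisy
projection step towards s_k: with u_k = η_k γ_k it multiplies E‖x_k - s_k‖² by at most 1 - 2u_k and
adds O(γ_k²) (`integral_step_le`).

The target drifts. Averages of a bounded map over nested balls of radii a ≤ b differ by O(n(1 -
a/b)), and strong monotonicity divides such perturbations by η, whence ‖s_{k-1} - s_k‖² = O(η_k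
γ_k³/ε_k²) (`norm_sub_sq_le_of_variation`). Absorbing the drift costs half of the contraction, so
a_k = E‖x_{k+1} - s_k‖² eventually obeys a_k ≤ (1 - u_k) a_{k-1} + u_k·O(q_k) with q_k = γ_k/(η_k
ε_k²) (`recursion_of_step`). Here q_k → 0, while ∑ u_k = ∞: otherwise q_k ≤ q_{k+1}(1 + δ u_{k+1})
would keep q_k away from 0. Hence a_k → 0.

The rest is deterministic. F_k → F uniformly on X, so cluster points of s_k solve VI(X, F); if also
ε_k/η_k → 0 and F has bounded Jacobian near t*, the only cluster point is t*. Both distance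
functions are 1-Lipschitz, so the limits pass from s_k to x_k. -/

namespace RSSA

/-! ### Scalar recursions, Euclidean projections, strongly monotone inequalities -/

section

/-- A nonnegative sequence with `a (k+1) ≤ (1 - u k) a k + u k b k`, where `∑ u = ∞` and `b → 0`,
tends to zero. -/
theorem tendsto_zero_of_le_one_sub_mul_add {a u b : ℕ → ℝ} (ha : ∀ k, 0 ≤ a k)
    (hu0 : ∀ k, 0 ≤ u k) (hu1 : ∀ᶠ k in atTop, u k ≤ 1) (hu : ¬ Summable u)
    (hb : Tendsto b atTop (𝓝 0))
    (h : ∀ᶠ k in atTop, a (k + 1) ≤ (1 - u k) * a k + u k * b k) :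
    Tendsto a atTop (𝓝 0) := by
  have hsum : Tendsto (fun N => ∑ i ∈ Finset.range N, u i) atTop atTop :=
    (not_summable_iff_tendsto_nat_atTop_of_nonneg hu0).1 hu
  refine (tendsto_order.2 ⟨fun c hc => Eventually.of_forall fun k => hc.trans_le (ha k), ?_⟩)
  intro c hc
  obtain ⟨K, hK⟩ := eventually_atTop.1 (hu1.and (h.and (hb.eventually_le_const (half_pos hc))))
  set S : ℕ → ℝ := fun N => ∑ i ∈ Finset.range N, u i
  -- Subtracting c/2 absorbs the term u * b. The truncation at 0 is needed because 1 - u ≤ exp (-u)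
  -- may only multiply a nonnegative quantity.
  set v : ℝ := max (a K - c / 2) 0
  have hv : 0 ≤ v := le_max_right _ _
  have key : ∀ k ≥ K, a k - c / 2 ≤ v * Real.exp (S K - S k) := by
    intro k hk
    induction k, hk using Nat.le_induction with
    | base => simp [v]
    | succ k hk ih =>
      obtain ⟨h1, h2, h3⟩ := hK k hk
      have e1 : S (k + 1) = S k + u k := Finset.sum_range_succ _ _
      have e2 : 1 - u k ≤ Real.exp (-u k) := by
        have := Real.add_one_le_exp (-u k); linarith
      have e3 : 0 ≤ v * Real.exp (S K - S k) := by positivity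
      calc a (k + 1) - c / 2 ≤ (1 - u k) * (a k - c / 2) := by
            nlinarith [mul_le_mul_of_nonneg_left h3 (hu0 k)]
        _ ≤ (1 - u k) * (v * Real.exp (S K - S k)) :=
            mul_le_mul_of_nonneg_left ih (by linarith)
        _ ≤ Real.exp (-u k) * (v * Real.exp (S K - S k)) := mul_le_mul_of_nonneg_right e2 e3
        _ = v * Real.exp (S K - S (k + 1)) := by
            rw [e1, show S K - (S k + u k) = -u k + (S K - S k) by ring, Real.exp_add]; ring
  have hlim : Tendsto (fun k => v * Real.exp (S K - S k)) atTop (𝓝 0) := by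
    have : Tendsto (fun k => Real.exp (S K - S k)) atTop (𝓝 0) :=
      Real.tendsto_exp_atBot.comp (tendsto_atBot_add_const_left _ _
        (tendsto_neg_atTop_atBot.comp hsum))
    simpa using this.const_mul v
  filter_upwards [hlim.eventually_lt_const (half_pos hc), eventually_ge_atTop K] with k h1 h2
  have := key k h2
  linarith

/-- A positive null sequence whose relative decrease is controlled by `u` forces `∑ u = ∞`. -/
theorem not_summable_of_le_mul_one_add {r u : ℕ → ℝ} {δ : ℝ} {K : ℕ} (hδ : 0 ≤ δ)
    (hr : ∀ k, 0 < r k) (hu : ∀ k, 0 ≤ u k) (hr0 : Tendsto r atTop (𝓝 0))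
    (h : ∀ k ≥ K, r k ≤ r (k + 1) * (1 + δ * u (k + 1))) : ¬ Summable u := by
  intro hs
  -- The sum starts at 0 rather than K + 1; the extra nonnegative terms only weaken the bound.
  have key : ∀ k ≥ K, r K ≤ r k * Real.exp (δ * ∑ i ∈ Finset.range (k + 1), u i) := by
    intro k hk
    induction k, hk using Nat.le_induction with
    | base =>
      refine le_mul_of_one_le_right (hr K).le (Real.one_le_exp ?_)
      exact mul_nonneg hδ (Finset.sum_nonneg fun i _ => hu i)
    | succ k hk ih =>
      rw [Finset.sum_range_succ, mul_add, Real.exp_add]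
      have h1 : 1 + δ * u (k + 1) ≤ Real.exp (δ * u (k + 1)) := by
        have := Real.add_one_le_exp (δ * u (k + 1)); linarith
      calc r K ≤ r k * Real.exp (δ * ∑ i ∈ Finset.range (k + 1), u i) := ih
        _ ≤ (r (k + 1) * Real.exp (δ * u (k + 1))) *
            Real.exp (δ * ∑ i ∈ Finset.range (k + 1), u i) := by
            refine mul_le_mul_of_nonneg_right ?_ (Real.exp_pos _).le
            exact (h k hk).trans (mul_le_mul_of_nonneg_left h1 (hr _).le)
        _ = _ := by ring
  have key2 : ∀ k ≥ K, r K ≤ r k * Real.exp (δ * ∑' i, u i) := fun k hk =>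
    (key k hk).trans (mul_le_mul_of_nonneg_left (Real.exp_le_exp.2
      (mul_le_mul_of_nonneg_left (hs.sum_le_tsum _ fun i _ => hu i) hδ)) (hr k).le)
  have hlim := hr0.mul_const (Real.exp (δ * ∑' i, u i))
  rw [zero_mul] at hlim
  exact absurd (hr K) (not_lt.2 (ge_of_tendsto hlim
    ((eventually_ge_atTop K).mono fun k hk => key2 k hk)))

variable {n d : ℕ} {X : Set (Vec n)}

theorem IsProjection.inner_sub_le_zero (hX : Convex ℝ X) {v p : Vec n} (h : IsProjection X v p)
    {y : Vec n} (hy : y ∈ X) : ⟪v - p, y - p⟫ ≤ 0 := by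
  have : Nonempty X := ⟨⟨p, h.1⟩⟩
  refine (norm_eq_iInf_iff_real_inner_le_zero hX h.1).1 (le_antisymm ?_ ?_) y hy
  · exact le_ciInf fun w => h.2 w w.2
  · exact ciInf_le ⟨0, by rintro _ ⟨w, rfl⟩; positivity⟩ (⟨p, h.1⟩ : X)

theorem exists_isProjection (hc : IsClosed X) (hX : Convex ℝ X) (hne : X.Nonempty) (v : Vec n) :
    ∃ p, IsProjection X v p := by
  obtain ⟨p, hp, h⟩ := exists_norm_eq_iInf_of_complete_convex hne hc.isComplete hX v
  refine ⟨p, hp, fun y hy => h.le.trans ?_⟩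
  exact ciInf_le ⟨0, by rintro _ ⟨w, rfl⟩; positivity⟩ (⟨y, hy⟩ : X)

theorem isProjection_self {v : Vec n} (hv : v ∈ X) : IsProjection X v v :=
  ⟨hv, fun y _ => by simp⟩

/-- Add the two obtuse-angle inequalities, each tested at the other projection, and apply
Cauchy–Schwarz. -/
theorem IsProjection.norm_sub_le (hX : Convex ℝ X) {v w p q : Vec n} (hp : IsProjection X v p)
    (hq : IsProjection X w q) : ‖p - q‖ ≤ ‖v - w‖ := by
  have h1 := hp.inner_sub_le_zero hX hq.1
  have h2 := hq.inner_sub_le_zero hX hp.1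
  have h3 : ‖p - q‖ * ‖p - q‖ ≤ ‖v - w‖ * ‖p - q‖ := by
    refine le_trans ?_ (real_inner_le_norm (v - w) (p - q))
    rw [← real_inner_self_eq_norm_mul_norm]
    have : ⟪v - w, p - q⟫ - ⟪p - q, p - q⟫ = -⟪v - p, q - p⟫ - ⟪w - q, p - q⟫ := by
      simp only [inner_sub_left, inner_sub_right]; ring
    linarith
  rcases (norm_nonneg (p - q)).eq_or_lt with h | h
  · rw [← h]; positivity
  · exact le_of_mul_le_mul_right h3 h

theorem exists_continuous_projection (hc : IsClosed X) (hX : Convex ℝ X) (hne : X.Nonempty) :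
    ∃ π : Vec n → Vec n, Continuous π ∧ (∀ v, IsProjection X v (π v)) ∧
      ∀ v p, IsProjection X v p → p = π v := by
  choose π hπ using exists_isProjection hc hX hne
  refine ⟨π, ?_, hπ, fun v p hp => ?_⟩
  · refine (LipschitzWith.of_dist_le_mul (K := 1) fun v w => ?_).continuous
    simpa [dist_eq_norm] using (hπ v).norm_sub_le hX (hπ w)
  · have := hp.norm_sub_le hX (hπ v)
    rw [sub_self, norm_zero] at this
    exact sub_eq_zero.1 (norm_le_zero_iff.1 this)

/-- A Lipschitz, strongly monotone map has a solution of its variational inequality. -/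
theorem SOL_nonempty_of_stronglyMonotone (hc : IsClosed X) (hX : Convex ℝ X) (hne : X.Nonempty)
    {G : Vec n → Vec n} {L m : ℝ} (hm : 0 < m)
    (hL : ∀ x ∈ X, ∀ y ∈ X, ‖G x - G y‖ ≤ L * ‖x - y‖)
    (hG : ∀ x ∈ X, ∀ y ∈ X, m * ‖x - y‖ ^ 2 ≤ ⟪G x - G y, x - y⟫) : (SOL X G).Nonempty := by
  obtain ⟨π, -, hπ, hπu⟩ := exists_continuous_projection hc hX hne
  -- Enlarging L to at least m makes M positive and q nonnegative.
  set M : ℝ := max L m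
  have hM : 0 < M := lt_max_of_lt_right hm
  -- This step length minimizes the squared contraction factor 1 - 2αm + α²M²; the minimum is q.
  -- Fixed points of the projected step are exactly solutions.
  set α : ℝ := m / M ^ 2
  have hα : 0 < α := by positivity
  set q : ℝ := 1 - m ^ 2 / M ^ 2
  have hq0 : 0 ≤ q := by
    have : m ^ 2 / M ^ 2 ≤ 1 := by
      rw [div_le_one (by positivity)]
      exact pow_le_pow_left₀ hm.le (le_max_right _ _) 2
    simp only [q]; linarith
  have hq1 : q < 1 := by
    have : 0 < m ^ 2 / M ^ 2 := by positivity
    simp only [q]; linarith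
  let T : X → X := fun x => ⟨π (x - α • G x), (hπ _).1⟩
  have : CompleteSpace X := hc.completeSpace_coe
  have : Nonempty X := hne.to_subtype
  have hT : ContractingWith (√q).toNNReal T := by
    refine ⟨?_, LipschitzWith.of_dist_le_mul fun x y => ?_⟩
    · rw [Real.toNNReal_lt_one]
      exact (Real.sqrt_lt' one_pos).2 (by simpa using hq1)
    · rw [Subtype.dist_eq, Subtype.dist_eq, dist_eq_norm, dist_eq_norm]
      refine ((hπ _).norm_sub_le hX (hπ _)).trans ?_
      refine abs_le_of_sq_le_sq' ?_ (by positivity) |>.2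
      rw [mul_pow, Real.coe_toNNReal _ (Real.sqrt_nonneg q), Real.sq_sqrt hq0]
      have e : (x : Vec n) - α • G x - (y - α • G y) = (x - y : Vec n) - α • (G x - G y) := by
        rw [smul_sub]; abel
      rw [e, norm_sub_sq_real, norm_smul, inner_smul_right, real_inner_comm, mul_pow,
        Real.norm_eq_abs, sq_abs]
      have h1 := hG x x.2 y y.2
      have h2 : ‖G x - G y‖ ^ 2 ≤ M ^ 2 * ‖(x : Vec n) - y‖ ^ 2 := by
        rw [← mul_pow]
        refine pow_le_pow_left₀ (norm_nonneg _) ((hL x x.2 y y.2).trans ?_) 2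
        exact mul_le_mul_of_nonneg_right (le_max_left _ _) (norm_nonneg _)
      have e2 : α ^ 2 * M ^ 2 = m ^ 2 / M ^ 2 := by simp only [α]; field_simp
      have e3 : α * m = m ^ 2 / M ^ 2 := by simp only [α]; field_simp
      have h3 := mul_le_mul_of_nonneg_left h1 hα.le
      have h4 := mul_le_mul_of_nonneg_left h2 (sq_nonneg α)
      rw [← mul_assoc, e3] at h3
      rw [← mul_assoc, e2] at h4
      simp only [q]
      linarith
  set s := hT.fixedPoint T
  have hs : π (s - α • G s) = s := congrArg Subtype.val hT.fixedPoint_isFixedPt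
  refine ⟨s, s.2, fun y hy => ?_⟩
  have := (hπ (s - α • G s)).inner_sub_le_zero hX hy
  rw [hs, sub_sub_cancel_left, inner_neg_left, real_inner_smul_left] at this
  exact nonneg_of_mul_nonneg_right (by linarith : 0 ≤ α * ⟪G s, y - s⟫) hα

end

/-! ### Averages over balls and the smoothed map -/

section

/-- Averages of a bounded function over nested sets `A ⊆ B` are close when `μ A / μ B` is close
to one. -/
theorem norm_integral_cond_sub_le {α E : Type*} [MeasurableSpace α] [NormedAddCommGroup E]
    [NormedSpace ℝ E] {μ : Measure α} {A B : Set α} (hAB : A ⊆ B) (hA : MeasurableSet A)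
    (hA0 : μ A ≠ 0) (hB : μ B ≠ ⊤) {f : α → E} {M : ℝ} (hf : IntegrableOn f B μ)
    (hM : ∀ x ∈ B, ‖f x‖ ≤ M) :
    ‖∫ x, f x ∂μ[|A] - ∫ x, f x ∂μ[|B]‖ ≤ 2 * M * (1 - μ.real A / μ.real B) := by
  have hAt : μ A ≠ ⊤ := ne_top_of_le_ne_top hB (measure_mono hAB)
  have hB0 : μ B ≠ 0 := fun h => hA0 (measure_mono_null hAB h)
  have ha : 0 < μ.real A := ENNReal.toReal_pos hA0 hAt
  have hb : 0 < μ.real B := ENNReal.toReal_pos hB0 hB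
  have hab : μ.real A ≤ μ.real B := measureReal_mono hAB hB
  have e : ∀ S : Set α, ∫ x, f x ∂μ[|S] = (μ.real S)⁻¹ • ∫ x in S, f x ∂μ := fun S => by
    rw [ProbabilityTheory.cond, integral_smul_measure, ENNReal.toReal_inv]; rfl
  have e2 : ∫ x in B, f x ∂μ = ∫ x in A, f x ∂μ + ∫ x in B \ A, f x ∂μ := by
    rw [setIntegral_sdiff hA hf hAB]; abel
  have h1 : ‖∫ x in A, f x ∂μ‖ ≤ M * μ.real A :=
    norm_setIntegral_le_of_norm_le_const hAt.lt_top fun x hx => hM x (hAB hx)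
  have h2 : ‖∫ x in B \ A, f x ∂μ‖ ≤ M * (μ.real B - μ.real A) := by
    rw [← measureReal_sdiff hAB hA hB]
    exact norm_setIntegral_le_of_norm_le_const
      ((measure_mono Set.sdiff_subset).trans_lt hB.lt_top) fun x hx => hM x hx.1
  -- Each of the two resulting terms has norm at most M (1 - μ A / μ B), hence the factor 2.
  have e3 : (μ.real A)⁻¹ • ∫ x in A, f x ∂μ -
      (μ.real B)⁻¹ • (∫ x in A, f x ∂μ + ∫ x in B \ A, f x ∂μ) =
      ((μ.real A)⁻¹ - (μ.real B)⁻¹) • ∫ x in A, f x ∂μ -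
        (μ.real B)⁻¹ • ∫ x in B \ A, f x ∂μ := by
    rw [smul_add, sub_smul]; abel
  rw [e, e, e2, e3]
  refine (norm_sub_le _ _).trans ?_
  rw [norm_smul, norm_smul, Real.norm_of_nonneg (sub_nonneg.2 (inv_anti₀ ha hab)),
    Real.norm_of_nonneg (inv_nonneg.2 hb.le)]
  calc _ ≤ ((μ.real A)⁻¹ - (μ.real B)⁻¹) * (M * μ.real A) +
        (μ.real B)⁻¹ * (M * (μ.real B - μ.real A)) :=
        add_le_add (mul_le_mul_of_nonneg_left h1 (sub_nonneg.2 (inv_anti₀ ha hab)))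
          (mul_le_mul_of_nonneg_left h2 (inv_nonneg.2 hb.le))
    _ = 2 * M * (1 - μ.real A / μ.real B) := by field_simp; ring

variable {n : ℕ} {X : Set (Vec n)} {F : Vec n → Vec n} {ρ : ℝ}

theorem volume_closedBall_ne_zero (x : Vec n) {r : ℝ} (hr : 0 < r) :
    volume (Metric.closedBall x r) ≠ 0 := (Metric.measure_closedBall_pos _ _ hr).ne'

theorem volume_closedBall_ne_top (x : Vec n) (r : ℝ) :
    volume (Metric.closedBall x r) ≠ ⊤ := measure_closedBall_lt_top.ne

theorem isProbabilityMeasure_cond_closedBall (x : Vec n) {r : ℝ} (hr : 0 < r) :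
    IsProbabilityMeasure (volume[|Metric.closedBall x r]) :=
  cond_isProbabilityMeasure_of_finite (volume_closedBall_ne_zero x hr)
    (volume_closedBall_ne_top x r)

theorem ae_mem_cond_closedBall (x : Vec n) (r : ℝ) :
    ∀ᵐ u ∂(volume[|Metric.closedBall x r]), u ∈ Metric.closedBall x r :=
  ae_cond_mem Metric.isClosed_closedBall.measurableSet

/-- For concentric or internally touching balls, `1 - |A| / |B|` is controlled by the radii. -/
theorem one_sub_volume_div_le (x y : Vec n) {a b : ℝ} (ha : 0 ≤ a) (hb : 0 < b) :
    1 - volume.real (Metric.closedBall x a) / volume.real (Metric.closedBall y b)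
      ≤ n * (1 - a / b) := by
  have h1 : 0 < volume.real (Metric.closedBall (0 : Vec n) 1) :=
    ENNReal.toReal_pos (volume_closedBall_ne_zero 0 one_pos) (volume_closedBall_ne_top 0 1)
  rw [Measure.addHaar_real_closedBall' _ x ha, Measure.addHaar_real_closedBall' _ y hb.le,
    mul_div_mul_right _ _ h1.ne', ← div_pow, finrank_euclideanSpace_fin]
  have h2 : (0 : ℝ) ≤ a / b := by positivity
  -- Bernoulli's inequality for (a / b)ⁿ.
  have := one_add_mul_le_pow (a := a / b - 1) (by linarith) n
  rw [add_sub_cancel] at this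
  linarith

/-- The average of `F` over the closed ball of radius `r` centered at `x`. -/
noncomputable def smoothing (F : Vec n → Vec n) (r : ℝ) (x : Vec n) : Vec n :=
  ∫ u, F (x + u) ∂(volume[|Metric.closedBall (0 : Vec n) r])

/-- Translation moves the dependence on x from the integrand to the domain, so that two smoothings
become averages of one function over different balls. -/
theorem smoothing_eq (F : Vec n → Vec n) (r : ℝ) (x : Vec n) :
    smoothing F r x = ∫ v, F v ∂(volume[|Metric.closedBall x r]) := by
  have hpre : (fun u => x + u) ⁻¹' Metric.closedBall x r = Metric.closedBall 0 r := by
    ext u; simp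
  have hvol : volume (Metric.closedBall x r) = volume (Metric.closedBall (0 : Vec n) r) := by
    rw [← hpre, (measurePreserving_add_left volume x).measure_preimage
      Metric.isClosed_closedBall.measurableSet.nullMeasurableSet]
  have hint := (measurePreserving_add_left (volume : Measure (Vec n)) x).setIntegral_preimage_emb
    (measurableEmbedding_addLeft x) F (Metric.closedBall x r)
  rw [hpre] at hint
  rw [smoothing, ProbabilityTheory.cond, ProbabilityTheory.cond, integral_smul_measure,
    integral_smul_measure, hvol, hint]

theorem closedBall_subset_enlargement {x : Vec n} (hx : x ∈ X) {r : ℝ} (hr : r ≤ ρ) :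
    Metric.closedBall x r ⊆ enlargement X ρ := by
  intro v hv
  refine ⟨x, hx, v - x, ?_, add_sub_cancel _ _⟩
  rw [mem_closedBall_zero_iff, ← dist_eq_norm]
  exact (Metric.mem_closedBall.1 hv).trans hr

theorem add_mem_enlargement {x u : Vec n} (hx : x ∈ X) {r : ℝ} (hr : r ≤ ρ)
    (hu : u ∈ Metric.closedBall (0 : Vec n) r) : x + u ∈ enlargement X ρ :=
  ⟨x, hx, u, Metric.closedBall_subset_closedBall hr hu, rfl⟩

theorem subset_enlargement (hρ : 0 ≤ ρ) : X ⊆ enlargement X ρ := fun x hx =>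
  ⟨x, hx, 0, by simpa using hρ, add_zero x⟩

theorem integrableOn_closedBall (hF : ContinuousOn F (enlargement X ρ)) {x : Vec n} (hx : x ∈ X)
    {r : ℝ} (hr : r ≤ ρ) : IntegrableOn F (Metric.closedBall x r) :=
  (hF.mono (closedBall_subset_enlargement hx hr)).integrableOn_compact
    (isCompact_closedBall x r)

theorem integrable_comp_add (hF : ContinuousOn F (enlargement X ρ)) {x : Vec n} (hx : x ∈ X)
    {r : ℝ} (hr0 : 0 < r) (hr : r ≤ ρ) :
    Integrable (fun u => F (x + u)) (volume[|Metric.closedBall (0 : Vec n) r]) := by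
  refine Integrable.smul_measure ?_ (ENNReal.inv_ne_top.2 (volume_closedBall_ne_zero 0 hr0))
  refine ContinuousOn.integrableOn_compact (isCompact_closedBall _ _) ?_
  exact hF.comp (by fun_prop) fun u hu => add_mem_enlargement hx hr hu

/-- Comparison of nested balls covers both a change of radius and a change of centre. Only the
larger ball needs its centre in X. -/
theorem smoothing_sub_smoothing_le (hF : ContinuousOn F (enlargement X ρ)) {M : ℝ}
    (hM : ∀ v ∈ enlargement X ρ, ‖F v‖ ≤ M) (hM0 : 0 ≤ M) {x : Vec n} (hx : x ∈ X) {y : Vec n}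
    {a b : ℝ} (ha : 0 < a) (hab : a ≤ b) (hb : b ≤ ρ)
    (hsub : Metric.closedBall y a ⊆ Metric.closedBall x b) :
    ‖smoothing F a y - smoothing F b x‖ ≤ 2 * M * (n * (1 - a / b)) := by
  rw [smoothing_eq, smoothing_eq]
  refine (norm_integral_cond_sub_le hsub Metric.isClosed_closedBall.measurableSet
    (volume_closedBall_ne_zero _ ha) (volume_closedBall_ne_top _ _)
    (integrableOn_closedBall hF hx hb)
    fun v hv => hM v (closedBall_subset_enlargement hx hb hv)).trans ?_
  exact mul_le_mul_of_nonneg_left (one_sub_volume_div_le y x ha.le (ha.trans_le hab))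
    (by positivity)

theorem smoothing_radius_sub_le (hF : ContinuousOn F (enlargement X ρ)) {M : ℝ}
    (hM : ∀ v ∈ enlargement X ρ, ‖F v‖ ≤ M) (hM0 : 0 ≤ M) {x : Vec n} (hx : x ∈ X)
    {a b : ℝ} (ha0 : 0 < a) (hb0 : 0 < b) (ha : a ≤ ρ) (hb : b ≤ ρ) :
    ‖smoothing F a x - smoothing F b x‖ ≤ 2 * M * (n * (1 - min a b / max a b)) := by
  rcases le_total a b with h | h
  · rw [min_eq_left h, max_eq_right h]
    exact smoothing_sub_smoothing_le hF hM hM0 hx ha0 h hb (Metric.closedBall_subset_closedBall h)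
  · rw [min_eq_right h, max_eq_left h, norm_sub_rev]
    exact smoothing_sub_smoothing_le hF hM hM0 hx hb0 h ha (Metric.closedBall_subset_closedBall h)

theorem norm_smoothing_le {M : ℝ} (hM : ∀ v ∈ enlargement X ρ, ‖F v‖ ≤ M) {x : Vec n}
    (hx : x ∈ X) {r : ℝ} (hr0 : 0 < r) (hr : r ≤ ρ) : ‖smoothing F r x‖ ≤ M := by
  have := isProbabilityMeasure_cond_closedBall (0 : Vec n) hr0
  refine (norm_integral_le_of_norm_le_const (C := M) ?_).trans (by simp)
  filter_upwards [ae_mem_cond_closedBall (0 : Vec n) r] with u hu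
  exact hM _ (add_mem_enlargement hx hr hu)

/-- If ‖x - y‖ < r, both balls contain the ball of radius r - ‖x - y‖ around x, and two nested
comparisons suffice. Otherwise the trivial bound 2M is enough. The blow-up as r → 0 is harmless: the
constant serves only the existence of regularized solutions. -/
theorem smoothing_lipschitz (hn : 1 ≤ n) (hF : ContinuousOn F (enlargement X ρ)) {M : ℝ}
    (hM : ∀ v ∈ enlargement X ρ, ‖F v‖ ≤ M) (hM0 : 0 ≤ M) {r : ℝ} (hr0 : 0 < r) (hr : r ≤ ρ) :
    ∀ x ∈ X, ∀ y ∈ X, ‖smoothing F r x - smoothing F r y‖ ≤ 4 * M * n / r * ‖x - y‖ := by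
  intro x hx y hy
  have hn' : (1 : ℝ) ≤ n := by exact_mod_cast hn
  rcases lt_or_ge ‖x - y‖ r with h | h
  · have h0 := norm_nonneg (x - y)
    have e : 1 - (r - ‖x - y‖) / r = ‖x - y‖ / r := by field_simp; ring
    have h1 := smoothing_sub_smoothing_le hF hM hM0 hx (y := x) (a := r - ‖x - y‖) (b := r)
      (by linarith) (by linarith) hr (Metric.closedBall_subset_closedBall (by linarith))
    have h2 := smoothing_sub_smoothing_le hF hM hM0 hy (y := x) (a := r - ‖x - y‖) (b := r)
      (by linarith) (by linarith) hr (Metric.closedBall_subset_closedBall' (by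
        rw [dist_eq_norm]; linarith))
    rw [e] at h1 h2
    rw [norm_sub_rev] at h1
    calc _ ≤ 2 * M * (n * (‖x - y‖ / r)) + 2 * M * (n * (‖x - y‖ / r)) :=
          (norm_sub_le_norm_sub_add_norm_sub _ _ _).trans (add_le_add h1 h2)
      _ = _ := by ring
  · have h1 := norm_smoothing_le hM hx hr0 hr
    have h2 := norm_smoothing_le hM hy hr0 hr
    have h3 : 1 ≤ ‖x - y‖ / r := (one_le_div hr0).2 h
    calc _ ≤ M + M := (norm_sub_le _ _).trans (add_le_add h1 h2)
      _ ≤ 4 * M * 1 * 1 := by linarith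
      _ ≤ 4 * M * n * (‖x - y‖ / r) := by gcongr
      _ = _ := by ring

/-- Both points are shifted by the same u, so monotonicity holds pointwise under the integral. -/
theorem smoothing_monotone (hF : ContinuousOn F (enlargement X ρ))
    (hmono : MonotoneOver F (enlargement X ρ)) {r : ℝ} (hr0 : 0 < r) (hr : r ≤ ρ) :
    MonotoneOver (smoothing F r) X := by
  intro x hx y hy
  have h1 := integrable_comp_add hF hx hr0 hr
  have h2 := integrable_comp_add hF hy hr0 hr
  rw [smoothing, smoothing, ← integral_sub h1 h2, real_inner_comm]
  refine le_of_le_of_eq ?_ (integral_inner (h1.sub h2) (x - y))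
  refine integral_nonneg_of_ae ?_
  filter_upwards [ae_mem_cond_closedBall (0 : Vec n) r] with u hu
  have := hmono _ (add_mem_enlargement hx hr hu) _ (add_mem_enlargement hy hr hu)
  rwa [add_sub_add_right_eq_sub, real_inner_comm] at this

theorem smoothing_sub_le (hF : ContinuousOn F (enlargement X ρ)) {x : Vec n} (hx : x ∈ X)
    {r : ℝ} (hr0 : 0 < r) (hr : r ≤ ρ) {c : ℝ}
    (hc : ∀ u ∈ Metric.closedBall (0 : Vec n) r, ‖F (x + u) - F x‖ ≤ c) :
    ‖smoothing F r x - F x‖ ≤ c := by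
  have := isProbabilityMeasure_cond_closedBall (0 : Vec n) hr0
  have e : smoothing F r x - F x =
      ∫ u, (F (x + u) - F x) ∂(volume[|Metric.closedBall (0 : Vec n) r]) := by
    rw [integral_sub (integrable_comp_add hF hx hr0 hr) (integrable_const _), integral_const]
    simp [smoothing]
  rw [e]
  refine (norm_integral_le_of_norm_le_const (C := c) ?_).trans (by simp)
  filter_upwards [ae_mem_cond_closedBall (0 : Vec n) r] with u hu using hc u hu

theorem isCompact_enlargement (hX : IsCompact X) : IsCompact (enlargement X ρ) :=
  hX.add (isCompact_closedBall _ _)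

/-- The smoothed maps converge to `F` uniformly on a compact set. -/
theorem eventually_smoothing_sub_le (hX : IsCompact X) (hF : ContinuousOn F (enlargement X ρ))
    {ε : ℕ → ℝ} (hε0 : ∀ k, 0 < ε k) (hερ : ∀ k, ε k ≤ ρ) (hε : Tendsto ε atTop (𝓝 0))
    {c : ℝ} (hc : 0 < c) : ∀ᶠ k in atTop, ∀ x ∈ X, ‖smoothing F (ε k) x - F x‖ ≤ c := by
  obtain ⟨δ, hδ, h⟩ := Metric.uniformContinuousOn_iff_le.1
    ((isCompact_enlargement hX).uniformContinuousOn_of_continuous hF) c hc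
  filter_upwards [hε.eventually_le_const hδ] with k hk x hx
  refine smoothing_sub_le hF hx (hε0 k) (hερ k) fun u hu => ?_
  rw [← dist_eq_norm]
  refine h _ (add_mem_enlargement hx (hερ k) hu) _
    (subset_enlargement ((hε0 k).le.trans (hερ k)) hx) ?_
  rw [dist_eq_norm, add_sub_cancel_left]
  exact (mem_closedBall_zero_iff.1 hu).trans hk

end

/-! ### The trajectory of smoothed and regularized solutions -/

section

variable {n : ℕ} {X : Set (Vec n)} {F : Vec n → Vec n} {ρ : ℝ}

/-- The smoothed and regularized variational inequality is solvable. -/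
theorem SOL_smoothing_add_smul_nonempty (hn : 1 ≤ n) (hc : IsClosed X) (hX : Convex ℝ X)
    (hne : X.Nonempty) (hF : ContinuousOn F (enlargement X ρ))
    (hmono : MonotoneOver F (enlargement X ρ)) {M : ℝ}
    (hM : ∀ v ∈ enlargement X ρ, ‖F v‖ ≤ M) (hM0 : 0 ≤ M) {r : ℝ} (hr0 : 0 < r) (hr : r ≤ ρ)
    {η : ℝ} (hη : 0 < η) : (SOL X fun x => smoothing F r x + η • x).Nonempty := by
  refine SOL_nonempty_of_stronglyMonotone hc hX hne hη (L := 4 * M * n / r + η)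
    (fun x hx y hy => ?_) fun x hx y hy => ?_
  · rw [add_sub_add_comm, ← smul_sub, add_mul]
    refine (norm_add_le _ _).trans
      (add_le_add (smoothing_lipschitz hn hF hM hM0 hr0 hr x hx y hy) ?_)
    rw [norm_smul, Real.norm_of_nonneg hη.le]
  · rw [add_sub_add_comm, ← smul_sub, inner_add_left, real_inner_smul_left,
      real_inner_self_eq_norm_sq]
    have := smoothing_monotone hF hmono hr0 hr x hx y hy
    linarith

/-- Sensitivity of solutions of regularized variational inequalities. -/
theorem mul_norm_sub_le_of_mem_SOL {G G' : Vec n → Vec n} (hG : MonotoneOver G X) {η η' : ℝ}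
    {s s' : Vec n} (hs : s ∈ SOL X fun x => G x + η • x)
    (hs' : s' ∈ SOL X fun x => G' x + η' • x) :
    η * ‖s - s'‖ ≤ ‖G s' - G' s'‖ + |η - η'| * ‖s'‖ := by
  have h1 := hs.2 s' hs'.1
  have h2 := hs'.2 s hs.1
  have h3 := hG s hs.1 s' hs'.1
  -- Each solution is tested in the other's inequality. The last three inner products are
  -- nonnegative by h3, h1, h2.
  have e : η * ⟪s - s', s - s'⟫ = ⟪G s' - G' s', s' - s⟫ + (η - η') * ⟪s', s' - s⟫
      - ⟪G s - G s', s - s'⟫ - ⟪G s + η • s, s' - s⟫ - ⟪G' s' + η' • s', s - s'⟫ := by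
    simp only [inner_sub_left, inner_sub_right, inner_add_left, real_inner_smul_left]
    rw [real_inner_comm s s']; ring
  have h4 : ⟪G s' - G' s', s' - s⟫ ≤ ‖G s' - G' s'‖ * ‖s - s'‖ := by
    rw [norm_sub_rev s]; exact real_inner_le_norm _ _
  have h5 : (η - η') * ⟪s', s' - s⟫ ≤ |η - η'| * ‖s'‖ * ‖s - s'‖ := by
    refine (le_abs_self _).trans ?_
    rw [abs_mul, mul_assoc, norm_sub_rev s]
    exact mul_le_mul_of_nonneg_left (abs_real_inner_le_norm _ _) (abs_nonneg _)
  rw [real_inner_self_eq_norm_mul_norm] at e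
  rcases (norm_nonneg (s - s')).eq_or_lt with h | h
  · rw [← h, mul_zero]; positivity
  · refine le_of_mul_le_mul_right ?_ h
    linarith

/-- Consecutive solutions of the smoothed and regularized problems differ by a controlled
amount. -/
theorem norm_sub_sq_le_of_variation (hF : ContinuousOn F (enlargement X ρ))
    (hmono : MonotoneOver F (enlargement X ρ)) {M : ℝ}
    (hM : ∀ v ∈ enlargement X ρ, ‖F v‖ ≤ M) (hM0 : 0 ≤ M) {R : ℝ} (hR : ∀ x ∈ X, ‖x‖ ≤ R)
    {ε₀ ε₁ η₀ η₁ γ₁ B₁ B₂ : ℝ} (hε₀ : 0 < ε₀) (hε₁ : 0 < ε₁) (hερ₀ : ε₀ ≤ ρ) (hερ₁ : ε₁ ≤ ρ)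
    (hη₀ : 0 < η₀) (hη₁ : 0 < η₁) (hγ₁ : 0 < γ₁)
    (hB₁ : ε₁ ^ 2 / (η₀ ^ 2 * η₁ * γ₁ ^ 3) * (1 - min ε₁ ε₀ / max ε₁ ε₀) ^ 2 ≤ B₁)
    (hB₂ : ε₁ ^ 2 / (η₁ * γ₁ ^ 3) * (1 - η₁ / η₀) ^ 2 ≤ B₂) {s₀ s₁ : Vec n}
    (hs₀ : s₀ ∈ SOL X fun x => smoothing F ε₀ x + η₀ • x)
    (hs₁ : s₁ ∈ SOL X fun x => smoothing F ε₁ x + η₁ • x) :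
    ‖s₀ - s₁‖ ^ 2 ≤ (2 * (2 * M * n) ^ 2 * B₁ + 2 * R ^ 2 * B₂) * (η₁ * γ₁ ^ 3 / ε₁ ^ 2) := by
  have h1 := mul_norm_sub_le_of_mem_SOL (smoothing_monotone hF hmono hε₀ hερ₀) hs₀ hs₁
  have h2 := smoothing_radius_sub_le hF hM hM0 hs₁.1 hε₀ hε₁ hερ₀ hερ₁
  rw [min_comm, max_comm] at h2
  set q := 1 - min ε₁ ε₀ / max ε₁ ε₀
  have h3 : |η₀ - η₁| * ‖s₁‖ ≤ |η₀ - η₁| * R :=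
    mul_le_mul_of_nonneg_left (hR _ hs₁.1) (abs_nonneg _)
  -- The first term is due to the change of radius, the second to the change of regularization.
  have h4 : ‖s₀ - s₁‖ ≤ 2 * M * n * (q / η₀) + R * |1 - η₁ / η₀| := by
    have e : |1 - η₁ / η₀| = |η₀ - η₁| / η₀ := by
      rw [one_sub_div hη₀.ne', abs_div, abs_of_pos hη₀]
    rw [e, ← mul_le_mul_iff_right₀ hη₀]
    calc _ ≤ _ := h1.trans (add_le_add h2 h3)
      _ = _ := by field_simp
  -- The scale for which the two hypotheses read (q / η₀)² ≤ B₁ w and (1 - η₁ / η₀)² ≤ B₂ w.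
  set w := η₁ * γ₁ ^ 3 / ε₁ ^ 2
  have hw : 0 < w := by positivity
  have h5 : (q / η₀) ^ 2 ≤ B₁ * w := by
    rw [← div_le_iff₀ hw]
    refine le_of_eq_of_le ?_ hB₁
    simp only [w]; field_simp
  have h6 : (1 - η₁ / η₀) ^ 2 ≤ B₂ * w := by
    rw [← div_le_iff₀ hw]
    refine le_of_eq_of_le ?_ hB₂
    simp only [w]; field_simp
  calc ‖s₀ - s₁‖ ^ 2 ≤ (2 * M * n * (q / η₀) + R * |1 - η₁ / η₀|) ^ 2 :=
        pow_le_pow_left₀ (norm_nonneg _) h4 2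
    _ ≤ 2 * ((2 * M * n * (q / η₀)) ^ 2 + (R * |1 - η₁ / η₀|) ^ 2) := add_sq_le
    _ = 2 * (2 * M * n) ^ 2 * (q / η₀) ^ 2 + 2 * R ^ 2 * (1 - η₁ / η₀) ^ 2 := by
        rw [mul_pow R, sq_abs]; ring
    _ ≤ 2 * (2 * M * n) ^ 2 * (B₁ * w) + 2 * R ^ 2 * (B₂ * w) := by gcongr
    _ = _ := by ring

/-- A continuous function vanishing at all cluster points of a sequence in a compact set tends to
zero along the sequence. -/
theorem tendsto_zero_of_cluster_points (hX : IsCompact X) {s : ℕ → Vec n} (hs : ∀ k, s k ∈ X)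
    {f : Vec n → ℝ} (hf : Continuous f)
    (h : ∀ ψ : ℕ → ℕ, Tendsto ψ atTop atTop → ∀ p ∈ X,
      Tendsto (fun k => s (ψ k)) atTop (𝓝 p) → f p = 0) :
    Tendsto (fun k => f (s k)) atTop (𝓝 0) := by
  refine tendsto_of_subseq_tendsto fun ns hns => ?_
  obtain ⟨p, hp, ψ, hψ, hlim⟩ := hX.tendsto_subseq fun k => hs (ns k)
  refine ⟨ψ, ?_⟩
  rw [← h (fun k => ns (ψ k)) (hns.comp hψ.tendsto_atTop) p hp hlim]
  exact (hf.tendsto p).comp hlim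

section Trajectory

variable {ε η : ℕ → ℝ} {s : ℕ → Vec n}

/-- Cluster points of the regularized solutions solve the original variational inequality. -/
theorem mem_SOL_of_tendsto (hX : IsCompact X) (hF : ContinuousOn F (enlargement X ρ))
    (hε0 : ∀ k, 0 < ε k) (hερ : ∀ k, ε k ≤ ρ) (hε : Tendsto ε atTop (𝓝 0))
    (hη : Tendsto η atTop (𝓝 0))
    (hs : ∀ k, s k ∈ SOL X fun x => smoothing F (ε k) x + η k • x)
    {ψ : ℕ → ℕ} (hψ : Tendsto ψ atTop atTop) {p : Vec n} (hp : p ∈ X)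
    (hlim : Tendsto (fun k => s (ψ k)) atTop (𝓝 p)) : p ∈ SOL X F := by
  have hρ : 0 ≤ ρ := (hε0 0).le.trans (hερ 0)
  have h1 : Tendsto (fun k => F (s (ψ k))) atTop (𝓝 (F p)) :=
    (((hF.mono (subset_enlargement hρ)) p hp).tendsto).comp
      (tendsto_nhdsWithin_iff.2 ⟨hlim, Eventually.of_forall fun k => (hs (ψ k)).1⟩)
  have h2 : Tendsto (fun k => smoothing F (ε k) (s k) - F (s k)) atTop (𝓝 0) := by
    refine Metric.tendsto_nhds.2 fun c hc => ?_
    filter_upwards [eventually_smoothing_sub_le hX hF hε0 hερ hε (half_pos hc)] with k hk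
    rw [dist_zero_right]
    exact (hk _ (hs k).1).trans_lt (half_lt_self hc)
  have h3 : Tendsto (fun k => smoothing F (ε (ψ k)) (s (ψ k)) + η (ψ k) • s (ψ k)) atTop
      (𝓝 (F p)) := by
    have := ((h2.comp hψ).add h1).add ((hη.comp hψ).smul hlim)
    rw [zero_add, zero_smul, add_zero] at this
    refine this.congr fun k => ?_
    simp
  refine ⟨hp, fun y hy => ?_⟩
  exact ge_of_tendsto' (h3.inner (tendsto_const_nhds.sub hlim)) fun k => (hs (ψ k)).2 y hy

theorem tendsto_infDist_SOL (hX : IsCompact X) (hF : ContinuousOn F (enlargement X ρ))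
    (hε0 : ∀ k, 0 < ε k) (hερ : ∀ k, ε k ≤ ρ) (hε : Tendsto ε atTop (𝓝 0))
    (hη : Tendsto η atTop (𝓝 0))
    (hs : ∀ k, s k ∈ SOL X fun x => smoothing F (ε k) x + η k • x) :
    Tendsto (fun k => Metric.infDist (s k) (SOL X F)) atTop (𝓝 0) :=
  tendsto_zero_of_cluster_points hX (fun k => (hs k).1) (Metric.continuous_infDist_pt _)
    fun _ hψ _ hp hlim => Metric.infDist_zero_of_mem
      (mem_SOL_of_tendsto hX hF hε0 hερ hε hη hs hψ hp hlim)

/-- If `ε k / η k → 0`, the regularized solutions converge to the least-norm solution. -/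
theorem tendsto_norm_sub_leastNorm (hX : IsCompact X) (hF : ContinuousOn F (enlargement X ρ))
    (hmono : MonotoneOver F (enlargement X ρ))
    (hε0 : ∀ k, 0 < ε k) (hερ : ∀ k, ε k ≤ ρ) (hε : Tendsto ε atTop (𝓝 0))
    (hη0 : ∀ k, 0 < η k) (hη : Tendsto η atTop (𝓝 0))
    (hs : ∀ k, s k ∈ SOL X fun x => smoothing F (ε k) x + η k • x)
    {t : Vec n} (ht : IsLeastNormSolution X F t)
    (hεη : Tendsto (fun k => ε k / η k) atTop (𝓝 0)) (hJ : BoundedJacobianNear F t) :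
    Tendsto (fun k => ‖s k - t‖) atTop (𝓝 0) := by
  obtain ⟨r, hr, J, hJ⟩ := hJ
  have hJ0 : 0 ≤ J := (norm_nonneg _).trans (hJ t (Metric.mem_ball_self hr)).2
  -- Test the inequality of s k at t and that of t at s k. Only the smoothing error at t survives;
  -- it is at most J * ε k by the mean value inequality, and dividing by η k leaves the vanishing
  -- ratio.
  have hkey : ∀ᶠ k in atTop, ⟪s k, s k - t⟫ ≤ J * (ε k / η k) * ‖t - s k‖ := by
    filter_upwards [hε.eventually_lt_const hr] with k hk
    have h1 := (hs k).2 t ht.1.1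
    have h2 := ht.1.2 (s k) (hs k).1
    have h3 := smoothing_monotone hF hmono (hε0 k) (hερ k) (s k) (hs k).1 t ht.1.1
    have h4 : ‖smoothing F (ε k) t - F t‖ ≤ J * ε k := by
      refine smoothing_sub_le hF ht.1.1 (hε0 k) (hερ k) fun u hu => ?_
      rw [mem_closedBall_zero_iff] at hu
      have := (convex_ball t r).norm_image_sub_le_of_norm_fderiv_le (𝕜 := ℝ) (f := F) (C := J)
        (fun y hy => (hJ y hy).1) (fun y hy => (hJ y hy).2) (Metric.mem_ball_self hr)
        (show t + u ∈ Metric.ball t r by simpa using hu.trans_lt hk)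
      rw [add_sub_cancel_left] at this
      exact this.trans (mul_le_mul_of_nonneg_left hu hJ0)
    have h5 : ⟪smoothing F (ε k) t - F t, t - s k⟫ ≤ J * ε k * ‖t - s k‖ :=
      (real_inner_le_norm _ _).trans (mul_le_mul_of_nonneg_right h4 (norm_nonneg _))
    have e : η k * ⟪s k, s k - t⟫ = ⟪smoothing F (ε k) t - F t, t - s k⟫
        - ⟪smoothing F (ε k) (s k) + η k • s k, t - s k⟫ - ⟪F t, s k - t⟫
        - ⟪smoothing F (ε k) (s k) - smoothing F (ε k) t, s k - t⟫ := by
      simp only [inner_sub_left, inner_sub_right, inner_add_left, real_inner_smul_left]; ring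
    rw [← mul_le_mul_iff_right₀ (hη0 k)]
    have e2 : η k * (J * (ε k / η k) * ‖t - s k‖) = J * ε k * ‖t - s k‖ := by
      have := (hη0 k).ne'
      field_simp
    linarith
  refine tendsto_zero_of_cluster_points hX (fun k => (hs k).1) (f := fun v => ‖v - t‖)
    (by fun_prop) fun ψ hψ p hp hlim => ?_
  have hpS := mem_SOL_of_tendsto hX hF hε0 hερ hε hη hs hψ hp hlim
  have h1 : ⟪p, p - t⟫ ≤ 0 := by
    have hl := hlim.inner (𝕜 := ℝ) (hlim.sub_const t)
    have hr' := ((hεη.comp hψ).const_mul J).mul (tendsto_const_nhds.sub hlim (a := t)).norm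
    rw [mul_zero, zero_mul] at hr'
    exact le_of_tendsto_of_tendsto hl hr' (hψ.eventually hkey)
  have h2 : ‖t‖ ^ 2 ≤ ‖p‖ ^ 2 := pow_le_pow_left₀ (norm_nonneg _) (ht.2 p hpS) 2
  -- By h1, ‖p‖² ≤ ⟪p, t⟫, so ‖p - t‖² ≤ ‖t‖² - ‖p‖², which is nonpositive by minimality of ‖t‖.
  have h3 : ‖p - t‖ ^ 2 ≤ 0 := by
    rw [norm_sub_sq_real]
    rw [inner_sub_right, real_inner_self_eq_norm_sq] at h1
    linarith
  exact pow_eq_zero_iff two_ne_zero |>.1 (le_antisymm h3 (sq_nonneg _))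

end Trajectory

end

/-! ### Independence of the iterates from the fresh inputs -/

section

section Independence

variable {Ω α β β' δ : Type*} [MeasurableSpace Ω] [MeasurableSpace α] [MeasurableSpace β]
  [MeasurableSpace β'] [MeasurableSpace δ] {P : Measure Ω} [IsProbabilityMeasure P]

/-- The joint law is the product of the three marginals, and products of measures are associative.
-/
theorem indepFun_prodMk_left {U : Ω → α} {V : Ω → β} {W : Ω → δ} (hU : Measurable U)
    (hV : Measurable V) (hW : Measurable W) (h : IndepFun U (fun ω => (V ω, W ω)) P)
    (hVW : IndepFun V W P) : IndepFun (fun ω => (U ω, V ω)) W P := by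
  have hUV : IndepFun U V P := h.comp measurable_id measurable_fst
  have := Measure.isProbabilityMeasure_map (μ := P) hU.aemeasurable
  have := Measure.isProbabilityMeasure_map (μ := P) hV.aemeasurable
  have := Measure.isProbabilityMeasure_map (μ := P) hW.aemeasurable
  rw [indepFun_iff_map_prod_eq_prod_map_map (by fun_prop) (by fun_prop)] at h hVW hUV ⊢
  rw [hUV]
  rw [hVW, ← Measure.prodAssoc_prod] at h
  have h2 := congrArg (Measure.map MeasurableEquiv.prodAssoc.symm) h
  rw [Measure.map_map (by fun_prop) (by fun_prop), Measure.map_map (by fun_prop) (by fun_prop),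
    MeasurableEquiv.symm_comp_self, Measure.map_id] at h2
  exact h2

theorem indepFun_prodMk_right {U : Ω → α} {V : Ω → β} {W : Ω → δ} (hU : Measurable U)
    (hV : Measurable V) (hW : Measurable W) (h : IndepFun (fun ω => (U ω, V ω)) W P)
    (hUV : IndepFun U V P) : IndepFun U (fun ω => (V ω, W ω)) P := by
  have h1 : IndepFun W (fun ω => (V ω, U ω)) P :=
    h.symm.comp measurable_id measurable_swap
  exact (indepFun_prodMk_left hW hV hU h1 hUV.symm).symm.comp measurable_id measurable_swap

/-- If the pairs `(A₁, A₂)` and `(B₁, B₂)` are independent of each other and each consists of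
independent components, then `(A₁, B₁)` is independent of `(B₂, A₂)`. -/
theorem indepFun_prodMk_prodMk {A₁ : Ω → α} {A₂ : Ω → β} {B₁ : Ω → β'} {B₂ : Ω → δ}
    (hA₁ : Measurable A₁) (hA₂ : Measurable A₂) (hB₁ : Measurable B₁) (hB₂ : Measurable B₂)
    (h : IndepFun (fun ω => (A₁ ω, A₂ ω)) (fun ω => (B₁ ω, B₂ ω)) P)
    (hA : IndepFun A₁ A₂ P) (hB : IndepFun B₁ B₂ P) :
    IndepFun (fun ω => (A₁ ω, B₁ ω)) (fun ω => (B₂ ω, A₂ ω)) P := by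
  have h1 : IndepFun A₁ (fun ω => (A₂ ω, (B₁ ω, B₂ ω))) P :=
    indepFun_prodMk_right hA₁ hA₂ (by fun_prop) h hA
  have h2 : IndepFun A₂ (fun ω => (B₁ ω, B₂ ω)) P := h.comp measurable_snd measurable_id
  have h3 : IndepFun (fun ω => (B₂ ω, A₂ ω)) B₁ P :=
    (indepFun_prodMk_left hA₂ hB₂ hB₁ (h2.comp measurable_id measurable_swap) hB.symm).comp
      measurable_swap measurable_id
  have h4 : Measurable fun p : β × β' × δ => (p.2.1, (p.2.2, p.1)) := by fun_prop
  exact indepFun_prodMk_left hA₁ hB₁ (by fun_prop) (h1.comp measurable_id h4) h3.symm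

end Independence

theorem IsRSSA.mem {n d : ℕ} {Ω : Type*} {X : Set (Vec n)} {Φ : Vec n → Vec d → Vec n}
    {γ η : ℕ → ℝ} {ξs : ℕ → Ω → Vec d} {z : ℕ → Ω → Vec n} {x : ℕ → Ω → Vec n}
    (hx : IsRSSA X Φ γ η ξs z x) (k : ℕ) (ω : Ω) : x k ω ∈ X := by
  cases k with
  | zero => exact hx.init ω
  | succ k => exact (hx.step k ω).1

/-- The `k`-th iterate is a measurable function of `x 0` and of the first `k` inputs. -/
theorem IsRSSA.exists_measurable_history {n d : ℕ} {Ω : Type*} {X : Set (Vec n)}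
    {Φ : Vec n → Vec d → Vec n} {γ η : ℕ → ℝ} {ξs : ℕ → Ω → Vec d} {z x : ℕ → Ω → Vec n}
    (hc : IsClosed X) (hX : Convex ℝ X) (hne : X.Nonempty)
    (hΦ : Measurable (Function.uncurry Φ)) (hx : IsRSSA X Φ γ η ξs z x) (k : ℕ) :
    ∃ g : Vec n × (Finset.range k → Vec d) × (Finset.range k → Vec n) → Vec n, Measurable g ∧
      ∀ ω, x k ω = g (x 0 ω, (fun i => ξs i ω), fun i => z i ω) := by
  obtain ⟨π, hπ, -, hπu⟩ := exists_continuous_projection hc hX hne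
  induction k with
  | zero => exact ⟨Prod.fst, measurable_fst, fun ω => rfl⟩
  | succ k ih =>
    obtain ⟨g, hg, hgx⟩ := ih
    have hsub : Finset.range k ⊆ Finset.range (k + 1) := Finset.range_mono k.le_succ
    have hk : k ∈ Finset.range (k + 1) := Finset.self_mem_range_succ k
    let G : Vec n × (Finset.range (k + 1) → Vec d) × (Finset.range (k + 1) → Vec n) → Vec n :=
      fun p => g (p.1, (fun i => p.2.1 ⟨i, hsub i.2⟩), fun i => p.2.2 ⟨i, hsub i.2⟩)
    have hG : Measurable G := hg.comp (by fun_prop)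
    -- `IsProjection` determines its point uniquely, so the next iterate is the continuous map π
    -- applied to the update.
    refine ⟨fun p => π (G p - γ k • (Function.uncurry Φ (G p + p.2.2 ⟨k, hk⟩, p.2.1 ⟨k, hk⟩) +
      η k • G p)), ?_, fun ω => ?_⟩
    · have h1 : Measurable fun p : Vec n × (Finset.range (k + 1) → Vec d) ×
          (Finset.range (k + 1) → Vec n) => (G p + p.2.2 ⟨k, hk⟩, p.2.1 ⟨k, hk⟩) := by fun_prop
      have h2 := hΦ.comp h1
      exact hπ.measurable.comp (hG.sub ((h2.add (hG.const_smul (η k))).const_smul (γ k)))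
    · have e : G (x 0 ω, (fun i => ξs i ω), fun i => z i ω) = x k ω := (hgx ω).symm
      simp only [e]
      exact hπu _ _ (hx.step k ω)

variable {n d : ℕ} {Ω : Type*} [MeasurableSpace Ω] {P : Measure Ω} {X : Set (Vec n)}
  {Φ : Vec n → Vec d → Vec n} {ξ : Ω → Vec d} {ξs : ℕ → Ω → Vec d} {z : ℕ → Ω → Vec n}
  {x : ℕ → Ω → Vec n} {γ η ε : ℕ → ℝ}

theorem IsRSSA.measurable (hc : IsClosed X) (hX : Convex ℝ X) (hne : X.Nonempty)
    (hΦ : Measurable (Function.uncurry Φ)) (hx : IsRSSA X Φ γ η ξs z x)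
    (hr : RandomInputs P ξ ξs z (x 0) ε) (k : ℕ) : Measurable (x k) := by
  obtain ⟨g, hg, hgx⟩ := hx.exists_measurable_history hc hX hne hΦ k
  rw [funext hgx]
  have h1 : Measurable fun ω => fun i : Finset.range k => ξs i ω :=
    measurable_pi_lambda _ fun i => hr.measurable_ξs i
  have h2 : Measurable fun ω => fun i : Finset.range k => z i ω :=
    measurable_pi_lambda _ fun i => hr.measurable_z i
  exact hg.comp (hr.measurable_x₀.prodMk (h1.prodMk h2))

variable [IsProbabilityMeasure P]

/-- The `k`-th iterate is independent of the `k`-th inputs. -/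
theorem IsRSSA.indepFun_inputs (hc : IsClosed X) (hX : Convex ℝ X) (hne : X.Nonempty)
    (hΦ : Measurable (Function.uncurry Φ)) (hx : IsRSSA X Φ γ η ξs z x)
    (hr : RandomInputs P ξ ξs z (x 0) ε) (k : ℕ) :
    IndepFun (x k) (fun ω => (z k ω, ξs k ω)) P := by
  obtain ⟨g, hg, hgx⟩ := hx.exists_measurable_history hc hX hne hΦ k
  let A₁ : Ω → Finset.range k → Vec d := fun ω i => ξs i ω
  let B₁ : Ω → Finset.range k → Vec n := fun ω i => z i ω
  have hA₁ : Measurable A₁ := measurable_pi_lambda _ fun i => hr.measurable_ξs i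
  have hB₁ : Measurable B₁ := measurable_pi_lambda _ fun i => hr.measurable_z i
  have hξk := hr.measurable_ξs k
  have hzk := hr.measurable_z k
  have hdisj : Disjoint (Finset.range k) {k} := by simp
  have hev : k ∈ ({k} : Finset ℕ) := Finset.mem_singleton_self k
  have hA : IndepFun A₁ (ξs k) P :=
    (hr.indep_ξs.indepFun_finset _ _ hdisj hr.measurable_ξs).comp measurable_id
      (measurable_pi_apply (⟨k, hev⟩ : ({k} : Finset ℕ)))
  have hB : IndepFun B₁ (z k) P :=
    (hr.indep_z.indepFun_finset _ _ hdisj hr.measurable_z).comp measurable_id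
      (measurable_pi_apply (⟨k, hev⟩ : ({k} : Finset ℕ)))
  have mξ : Measurable fun f : ℕ → Vec d => ((fun i : Finset.range k => f i), f k) := by fun_prop
  have mz : Measurable fun f : ℕ → Vec n => ((fun i : Finset.range k => f i), f k) := by fun_prop
  -- The past of each family is independent of its present value, and the two families are
  -- independent of each other; x 0 is adjoined afterwards.
  have hAB : IndepFun (fun ω => (A₁ ω, B₁ ω)) (fun ω => (z k ω, ξs k ω)) P :=
    indepFun_prodMk_prodMk hA₁ hξk hB₁ hzk (hr.indep_ξs_z.comp mξ mz) hA hB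
  have m₀ : Measurable fun p : (ℕ → Vec d) × (ℕ → Vec n) =>
      (((fun i : Finset.range k => p.1 i), fun i : Finset.range k => p.2 i), (p.2 k, p.1 k)) := by
    fun_prop
  have h := indepFun_prodMk_left hr.measurable_x₀ (hA₁.prodMk hB₁) (hzk.prodMk hξk)
    (hr.indep_x₀.comp measurable_id m₀) hAB
  rw [funext hgx]
  exact h.comp hg measurable_id

/-- The joint law of the `k`-th iterate and the `k`-th inputs. -/
theorem IsRSSA.map_inputs (hc : IsClosed X) (hX : Convex ℝ X) (hne : X.Nonempty)
    (hΦ : Measurable (Function.uncurry Φ)) (hx : IsRSSA X Φ γ η ξs z x)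
    (hr : RandomInputs P ξ ξs z (x 0) ε) (k : ℕ) :
    P.map (fun ω => (x k ω, (z k ω, ξs k ω))) =
      (P.map (x k)).prod ((volume[|Metric.closedBall (0 : Vec n) (ε k)]).prod (P.map ξ)) := by
  have hξk := hr.measurable_ξs k
  have hzk := hr.measurable_z k
  have h1 : IndepFun (z k) (ξs k) P :=
    (hr.indep_ξs_z.comp (measurable_pi_apply k) (measurable_pi_apply k)).symm
  rw [(hx.indepFun_inputs hc hX hne hΦ hr k).map_prod_eq_prod_map_map
    (hx.measurable hc hX hne hΦ hr k).aemeasurable (by fun_prop),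
    h1.map_prod_eq_prod_map_map hzk.aemeasurable hξk.aemeasurable, hr.uniform_z k,
    (hr.identDistrib_ξs k).map_eq]

end

/-! ### One step of the scheme in mean square -/

section

variable {n d : ℕ} {Ω : Type*} [MeasurableSpace Ω] {P : Measure Ω} [IsProbabilityMeasure P]
  {X : Set (Vec n)} {Φ : Vec n → Vec d → Vec n} {ξ : Ω → Vec d} {ρ C : ℝ}

/-- Second moments are bounded first as `lintegral`s, where Tonelli requires no integrability;
integrability is then a consequence. -/
theorem memLp_two_of_lintegral_le {α : Type*} [MeasurableSpace α] {μ : Measure α}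
    {f : α → Vec n} (hf : Measurable f) {c : ℝ} (h : ∫⁻ a, ‖f a‖ₑ ^ 2 ∂μ ≤ ENNReal.ofReal c) :
    MemLp f 2 μ := by
  refine ⟨hf.aestronglyMeasurable, ?_⟩
  rw [eLpNorm_lt_top_iff_lintegral_rpow_enorm_lt_top two_ne_zero ENNReal.ofNat_ne_top]
  simpa using h.trans_lt ENNReal.ofReal_lt_top

theorem integral_norm_sq_le_of_lintegral_le {α : Type*} [MeasurableSpace α] {μ : Measure α}
    {f : α → Vec n} (hf : Measurable f) {c : ℝ} (hc : 0 ≤ c)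
    (h : ∫⁻ a, ‖f a‖ₑ ^ 2 ∂μ ≤ ENNReal.ofReal c) : ∫ a, ‖f a‖ ^ 2 ∂μ ≤ c := by
  rw [integral_eq_lintegral_of_nonneg_ae (Eventually.of_forall fun a => by positivity)
    (by fun_prop)]
  refine ENNReal.toReal_le_of_le_ofReal hc (le_of_eq_of_le (lintegral_congr fun a => ?_) h)
  rw [ENNReal.ofReal_pow (norm_nonneg _), ofReal_norm]

/-- Conditional second moment of the sampled map at a point of `X`. -/
theorem ProblemProperties.lintegral_le (hp : ProblemProperties P X Φ ξ ρ C)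
    (hΦ : Measurable (Function.uncurry Φ)) (hξ : Measurable ξ) {r : ℝ} (hr0 : 0 < r)
    (hr : r ≤ ρ) {v : Vec n} (hv : v ∈ X) :
    ∫⁻ p : Vec n × Vec d, ‖Φ (v + p.1) p.2‖ₑ ^ 2
      ∂((volume[|Metric.closedBall (0 : Vec n) r]).prod (P.map ξ)) ≤ ENNReal.ofReal (C ^ 2) := by
  have := isProbabilityMeasure_cond_closedBall (0 : Vec n) hr0
  have := Measure.isProbabilityMeasure_map (μ := P) hξ.aemeasurable
  have m1 : Measurable fun p : Vec n × Vec d => Function.uncurry Φ (v + p.1, p.2) :=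
    hΦ.comp (by fun_prop)
  have m3 : AEMeasurable (fun p : Vec n × Vec d => ‖Φ (v + p.1) p.2‖ₑ ^ 2)
      ((volume[|Metric.closedBall (0 : Vec n) r]).prod (P.map ξ)) :=
    (m1.enorm.pow_const 2).aemeasurable
  rw [lintegral_prod _ m3]
  calc _ ≤ ∫⁻ _, ENNReal.ofReal (C ^ 2) ∂(volume[|Metric.closedBall (0 : Vec n) r]) := by
        refine lintegral_mono_ae ?_
        filter_upwards [ae_mem_cond_closedBall (0 : Vec n) r] with u hu
        obtain ⟨h1, h2⟩ := hp.secondMoment _ (add_mem_enlargement hv hr hu)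
        have m2 : Measurable fun w => Φ (v + u) w := m1.comp measurable_prodMk_left
        rw [lintegral_map (m2.enorm.pow_const 2) hξ]
        refine le_of_eq_of_le ?_ (ENNReal.ofReal_le_ofReal h2)
        rw [ofReal_integral_eq_lintegral_ofReal h1 (Eventually.of_forall fun ω => by positivity)]
        refine lintegral_congr fun ω => ?_
        rw [ENNReal.ofReal_pow (norm_nonneg _), ofReal_norm]
    _ = ENNReal.ofReal (C ^ 2) := by simp

/-- Conditional expectation of the sampled map at a point of `X`. -/
theorem ProblemProperties.integral_eq_smoothing (hp : ProblemProperties P X Φ ξ ρ C)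
    (hΦ : Measurable (Function.uncurry Φ)) (hξ : Measurable ξ) {r : ℝ} (hr0 : 0 < r)
    (hr : r ≤ ρ) {v : Vec n} (hv : v ∈ X) :
    Integrable (fun p : Vec n × Vec d => Φ (v + p.1) p.2)
      ((volume[|Metric.closedBall (0 : Vec n) r]).prod (P.map ξ)) ∧
    ∫ p : Vec n × Vec d, Φ (v + p.1) p.2
      ∂((volume[|Metric.closedBall (0 : Vec n) r]).prod (P.map ξ)) =
      smoothing (expMap P Φ ξ) r v := by
  have := isProbabilityMeasure_cond_closedBall (0 : Vec n) hr0
  have := Measure.isProbabilityMeasure_map (μ := P) hξ.aemeasurable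
  have m1 : Measurable fun p : Vec n × Vec d => Function.uncurry Φ (v + p.1, p.2) :=
    hΦ.comp (by fun_prop)
  have hint : Integrable (fun p : Vec n × Vec d => Φ (v + p.1) p.2)
      ((volume[|Metric.closedBall (0 : Vec n) r]).prod (P.map ξ)) :=
    (memLp_two_of_lintegral_le m1 (hp.lintegral_le hΦ hξ hr0 hr hv)).integrable one_le_two
  refine ⟨hint, ?_⟩
  rw [integral_prod _ hint, smoothing]
  refine integral_congr_ae (Eventually.of_forall fun u => ?_)
  have m2 : Measurable fun w => Φ (v + u) w := m1.comp measurable_prodMk_left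
  exact integral_map hξ.aemeasurable m2.aestronglyMeasurable

variable {Y Z : Ω → Vec n} {W : Ω → Vec d} {r : ℝ}

/-- Second moment of the sampled map at a random point of `X` independent of the sample. -/
theorem ProblemProperties.lintegral_comp_le (hp : ProblemProperties P X Φ ξ ρ C)
    (hΦ : Measurable (Function.uncurry Φ)) (hξ : Measurable ξ) (hr0 : 0 < r) (hr : r ≤ ρ)
    (hY : Measurable Y) (hZ : Measurable Z) (hW : Measurable W) (hYX : ∀ ω, Y ω ∈ X)
    (hlaw : P.map (fun ω => (Y ω, (Z ω, W ω))) =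
      (P.map Y).prod ((volume[|Metric.closedBall (0 : Vec n) r]).prod (P.map ξ))) :
    ∫⁻ ω, ‖Φ (Y ω + Z ω) (W ω)‖ₑ ^ 2 ∂P ≤ ENNReal.ofReal (C ^ 2) := by
  have := isProbabilityMeasure_cond_closedBall (0 : Vec n) hr0
  have := Measure.isProbabilityMeasure_map (μ := P) hξ.aemeasurable
  have := Measure.isProbabilityMeasure_map (μ := P) hY.aemeasurable
  have m1 : Measurable fun p : Vec n × Vec n × Vec d =>
      Function.uncurry Φ (p.1 + p.2.1, p.2.2) := hΦ.comp (by fun_prop)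
  have m2 := m1.enorm.pow_const 2
  have e : ∫⁻ ω, ‖Φ (Y ω + Z ω) (W ω)‖ₑ ^ 2 ∂P =
      ∫⁻ p : Vec n × Vec n × Vec d, ‖Function.uncurry Φ (p.1 + p.2.1, p.2.2)‖ₑ ^ 2
        ∂(P.map (fun ω => (Y ω, (Z ω, W ω)))) :=
    (lintegral_map m2 (hY.prodMk (hZ.prodMk hW))).symm
  rw [e, hlaw, lintegral_prod _ m2.aemeasurable, lintegral_map m2.lintegral_prod_right' hY]
  calc _ ≤ ∫⁻ _, ENNReal.ofReal (C ^ 2) ∂P :=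
        lintegral_mono fun ω => hp.lintegral_le hΦ hξ hr0 hr (hYX ω)
    _ = ENNReal.ofReal (C ^ 2) := by simp

/-- Mean strong monotonicity of the sampled regularized map. -/
theorem ProblemProperties.mul_integral_norm_sq_le (hp : ProblemProperties P X Φ ξ ρ C)
    (hΦ : Measurable (Function.uncurry Φ)) (hξ : Measurable ξ) (hr0 : 0 < r) (hr : r ≤ ρ)
    (hY : Measurable Y) (hZ : Measurable Z) (hW : Measurable W) (hYX : ∀ ω, Y ω ∈ X)
    (hlaw : P.map (fun ω => (Y ω, (Z ω, W ω))) =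
      (P.map Y).prod ((volume[|Metric.closedBall (0 : Vec n) r]).prod (P.map ξ)))
    {η : ℝ} {s : Vec n} (hs : s ∈ SOL X fun v => smoothing (expMap P Φ ξ) r v + η • v)
    (hint : Integrable (fun ω => ⟪Φ (Y ω + Z ω) (W ω) + η • Y ω, Y ω - s⟫) P)
    (hint' : Integrable (fun ω => ‖Y ω - s‖ ^ 2) P) :
    η * ∫ ω, ‖Y ω - s‖ ^ 2 ∂P ≤ ∫ ω, ⟪Φ (Y ω + Z ω) (W ω) + η • Y ω, Y ω - s⟫ ∂P := by
  have := isProbabilityMeasure_cond_closedBall (0 : Vec n) hr0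
  have := Measure.isProbabilityMeasure_map (μ := P) hξ.aemeasurable
  have := Measure.isProbabilityMeasure_map (μ := P) hY.aemeasurable
  set κ := (volume[|Metric.closedBall (0 : Vec n) r]).prod (P.map ξ) with hκ
  let H : Vec n × Vec n × Vec d → ℝ := fun p =>
    ⟪Function.uncurry Φ (p.1 + p.2.1, p.2.2) + η • p.1, p.1 - s⟫
  have m1 : Measurable fun p : Vec n × Vec n × Vec d =>
      Function.uncurry Φ (p.1 + p.2.1, p.2.2) := hΦ.comp (by fun_prop)
  have mH : Measurable H := by
    have m2 := m1.add (measurable_fst.const_smul η)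
    exact m2.inner (measurable_fst.sub_const s)
  have mT : Measurable fun ω => (Y ω, (Z ω, W ω)) := hY.prodMk (hZ.prodMk hW)
  have hH : Integrable H ((P.map Y).prod κ) := by
    rw [← hlaw]
    exact (integrable_map_measure mH.aestronglyMeasurable mT.aemeasurable).2 hint
  -- The product law permits integrating out the inputs with the iterate frozen, in place of a
  -- conditional expectation.
  have e : ∫ ω, ⟪Φ (Y ω + Z ω) (W ω) + η • Y ω, Y ω - s⟫ ∂P =
      ∫ ω, (∫ q, H (Y ω, q) ∂κ) ∂P := by
    calc _ = ∫ p, H p ∂(P.map (fun ω => (Y ω, (Z ω, W ω)))) :=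
          (integral_map mT.aemeasurable mH.aestronglyMeasurable).symm
      _ = _ := by
          rw [hlaw, integral_prod _ hH]
          exact integral_map hY.aemeasurable
            hH.integral_prod_left.aestronglyMeasurable
  rw [e, ← integral_const_mul]
  refine integral_mono (hint'.const_mul η) (hH.integral_prod_left.comp_measurable hY) fun ω => ?_
  obtain ⟨h1, h2⟩ := hp.integral_eq_smoothing hΦ hξ hr0 hr (hYX ω)
  have e2 : ∫ q, H (Y ω, q) ∂κ =
      ⟪smoothing (expMap P Φ ξ) r (Y ω) + η • Y ω, Y ω - s⟫ := by
    have h3 : ∫ q : Vec n × Vec d, (Φ (Y ω + q.1) q.2 + η • Y ω) ∂κ =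
        smoothing (expMap P Φ ξ) r (Y ω) + η • Y ω := by
      rw [integral_add h1 (integrable_const _), h2, integral_const]
      simp
    rw [← h3, real_inner_comm]
    refine Eq.trans ?_ (integral_inner (h1.add (integrable_const (η • Y ω))) (Y ω - s))
    exact integral_congr_ae (Eventually.of_forall fun q => real_inner_comm _ _)
  change η * ‖Y ω - s‖ ^ 2 ≤ ∫ q, H (Y ω, q) ∂κ
  rw [e2]
  have h4 := smoothing_monotone hp.continuous hp.monotone hr0 hr (Y ω) (hYX ω) s hs.1
  have h5 := hs.2 (Y ω) (hYX ω)
  have e3 : ⟪smoothing (expMap P Φ ξ) r (Y ω) + η • Y ω, Y ω - s⟫ =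
      ⟪smoothing (expMap P Φ ξ) r (Y ω) - smoothing (expMap P Φ ξ) r s, Y ω - s⟫ +
      ⟪smoothing (expMap P Φ ξ) r s + η • s, Y ω - s⟫ + η * ⟪Y ω - s, Y ω - s⟫ := by
    simp only [inner_sub_left, inner_sub_right, inner_add_left, real_inner_smul_left]; ring
  rw [e3, real_inner_self_eq_norm_sq]
  linarith

theorem integrable_norm_sub_sq_of_mem {R : ℝ} (hR : ∀ v ∈ X, ‖v‖ ≤ R) (hY : Measurable Y)
    (hYX : ∀ ω, Y ω ∈ X) {s : Vec n} (hs : s ∈ X) :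
    Integrable (fun ω => ‖Y ω - s‖ ^ 2) P := by
  refine Integrable.of_bound (by fun_prop) ((R + R) ^ 2) (Eventually.of_forall fun ω => ?_)
  rw [norm_pow, norm_norm]
  exact pow_le_pow_left₀ (norm_nonneg _)
    ((norm_sub_le _ _).trans (add_le_add (hR _ (hYX ω)) (hR _ hs))) 2

/-- One step of the scheme contracts the mean-square distance to the regularized solution up to
a term of order `γ²`. -/
theorem ProblemProperties.integral_step_le (hp : ProblemProperties P X Φ ξ ρ C)
    (hΦ : Measurable (Function.uncurry Φ)) (hξ : Measurable ξ) (hr0 : 0 < r) (hr : r ≤ ρ)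
    (hY : Measurable Y) (hZ : Measurable Z) (hW : Measurable W) (hYX : ∀ ω, Y ω ∈ X)
    (hlaw : P.map (fun ω => (Y ω, (Z ω, W ω))) =
      (P.map Y).prod ((volume[|Metric.closedBall (0 : Vec n) r]).prod (P.map ξ)))
    {R : ℝ} (hR : ∀ v ∈ X, ‖v‖ ≤ R)
    {γ η : ℝ} (hγ : 0 ≤ γ) (hη0 : 0 ≤ η) (hη1 : η ≤ 1)
    {s : Vec n} (hs : s ∈ SOL X fun v => smoothing (expMap P Φ ξ) r v + η • v)
    {Y' : Ω → Vec n} (hY' : Measurable Y')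
    (hstep : ∀ ω, IsProjection X (Y ω - γ • (Φ (Y ω + Z ω) (W ω) + η • Y ω)) (Y' ω)) :
    ∫ ω, ‖Y' ω - s‖ ^ 2 ∂P ≤
      (1 - 2 * (η * γ)) * ∫ ω, ‖Y ω - s‖ ^ 2 ∂P + γ ^ 2 * (2 * C ^ 2 + 2 * R ^ 2) := by
  have hlint := hp.lintegral_comp_le hΦ hξ hr0 hr hY hZ hW hYX hlaw
  have mA : Measurable fun ω => Φ (Y ω + Z ω) (W ω) :=
    hΦ.comp ((hY.add hZ).prodMk hW)
  set A : Ω → Vec n := fun ω => Φ (Y ω + Z ω) (W ω)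
  have hA2 : MemLp A 2 P := memLp_two_of_lintegral_le mA hlint
  have hAsq : Integrable (fun ω => ‖A ω‖ ^ 2) P := hA2.integrable_norm_pow two_ne_zero
  have hAle : ∫ ω, ‖A ω‖ ^ 2 ∂P ≤ C ^ 2 :=
    integral_norm_sq_le_of_lintegral_le mA (sq_nonneg C) hlint
  have hYs := integrable_norm_sub_sq_of_mem (P := P) hR hY hYX hs.1
  have hY's := integrable_norm_sub_sq_of_mem (P := P) hR hY' (fun ω => (hstep ω).1) hs.1
  have hYL : MemLp Y 2 P := MemLp.of_bound hY.aestronglyMeasurable R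
    (Eventually.of_forall fun ω => hR _ (hYX ω))
  have hin : Integrable (fun ω => ⟪A ω + η • Y ω, Y ω - s⟫) P := by
    have h1 := (hA2.add (hYL.const_smul η)).integrable one_le_two
    refine (h1.norm.mul_const (R + R)).mono'
      ((mA.add (hY.const_smul η)).inner (hY.sub_const s)).aestronglyMeasurable
      (Eventually.of_forall fun ω => (norm_inner_le_norm _ _).trans ?_)
    exact mul_le_mul_of_nonneg_left
      ((norm_sub_le _ _).trans (add_le_add (hR _ (hYX ω)) (hR _ hs.1))) (norm_nonneg _)
  have hmean := hp.mul_integral_norm_sq_le hΦ hξ hr0 hr hY hZ hW hYX hlaw hs hin hYs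
  -- The projection is nonexpansive and fixes s. The bound η ≤ 1 keeps the regularization term
  -- within R.
  have hpt : ∀ ω, ‖Y' ω - s‖ ^ 2 ≤ ‖Y ω - s‖ ^ 2 - 2 * γ * ⟪A ω + η • Y ω, Y ω - s⟫ +
      γ ^ 2 * (2 * ‖A ω‖ ^ 2 + 2 * R ^ 2) := fun ω => by
    have h1 := (hstep ω).norm_sub_le hp.convex (isProjection_self hs.1)
    have h2 := pow_le_pow_left₀ (norm_nonneg _) h1 2
    have e : Y ω - γ • (A ω + η • Y ω) - s = (Y ω - s) - γ • (A ω + η • Y ω) := by abel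
    rw [show Φ (Y ω + Z ω) (W ω) = A ω from rfl, e, norm_sub_sq_real (Y ω - s), real_inner_smul_right,
      real_inner_comm, norm_smul, mul_pow, Real.norm_eq_abs, sq_abs] at h2
    have h3 : ‖A ω + η • Y ω‖ ≤ ‖A ω‖ + R := by
      refine (norm_add_le _ _).trans (add_le_add le_rfl ?_)
      rw [norm_smul, Real.norm_of_nonneg hη0]
      exact (mul_le_of_le_one_left (norm_nonneg _) hη1).trans (hR _ (hYX ω))
    have h4 : ‖A ω + η • Y ω‖ ^ 2 ≤ 2 * ‖A ω‖ ^ 2 + 2 * R ^ 2 := by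
      refine (pow_le_pow_left₀ (norm_nonneg _) h3 2).trans (add_sq_le.trans_eq (by ring))
    have h5 := mul_le_mul_of_nonneg_left h4 (sq_nonneg γ)
    linarith
  have i1 : Integrable (fun ω => ‖Y ω - s‖ ^ 2 - 2 * γ * ⟪A ω + η • Y ω, Y ω - s⟫) P :=
    hYs.sub (hin.const_mul _)
  have i2 : Integrable (fun ω => γ ^ 2 * (2 * ‖A ω‖ ^ 2 + 2 * R ^ 2)) P :=
    ((hAsq.const_mul 2).add (integrable_const _)).const_mul _
  have h6 := integral_mono hY's (i1.add i2) hpt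
  have h7 : ∫ ω, (‖Y ω - s‖ ^ 2 - 2 * γ * ⟪A ω + η • Y ω, Y ω - s⟫ +
      γ ^ 2 * (2 * ‖A ω‖ ^ 2 + 2 * R ^ 2)) ∂P =
      ∫ ω, ‖Y ω - s‖ ^ 2 ∂P - 2 * γ * ∫ ω, ⟪A ω + η • Y ω, Y ω - s⟫ ∂P +
      γ ^ 2 * (2 * ∫ ω, ‖A ω‖ ^ 2 ∂P + 2 * R ^ 2) := by
    rw [integral_add i1 i2, integral_sub hYs (hin.const_mul _), integral_const_mul,
      integral_const_mul, integral_add (hAsq.const_mul 2) (integrable_const _),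
      integral_const_mul, integral_const]
    simp
  simp only [Pi.add_apply, h7] at h6
  have h8 : γ ^ 2 * (2 * ∫ ω, ‖A ω‖ ^ 2 ∂P + 2 * R ^ 2) ≤ γ ^ 2 * (2 * C ^ 2 + 2 * R ^ 2) := by
    gcongr
  have h9 := mul_le_mul_of_nonneg_left hmean (by positivity : 0 ≤ 2 * γ)
  linarith

end

/-! ### The perturbed contraction along the trajectory -/

section

variable {n d : ℕ} {Ω : Type*} [MeasurableSpace Ω] {P : Measure Ω} [IsProbabilityMeasure P]
  {X : Set (Vec n)} {Φ : Vec n → Vec d → Vec n} {ξ : Ω → Vec d} {ξs : ℕ → Ω → Vec d}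
  {z x : ℕ → Ω → Vec n} {γ η ε : ℕ → ℝ} {ρ C : ℝ}

/-- Young's inequality with a free weight; it is used with u = ηγ, so that changing the target
spends only half of the factor 1 - 2ηγ. -/
theorem norm_sub_sq_le_weighted {E : Type*} [NormedAddCommGroup E] (a b c : E) {u : ℝ}
    (hu : 0 < u) : ‖a - c‖ ^ 2 ≤ (1 + u) * ‖a - b‖ ^ 2 + (1 + 1 / u) * ‖b - c‖ ^ 2 := by
  have h1 := pow_le_pow_left₀ (norm_nonneg _) (norm_sub_le_norm_sub_add_norm_sub a b c) 2
  have h2 : 0 ≤ (u * ‖a - b‖ - ‖b - c‖) ^ 2 / u := by positivity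
  have h3 : (u * ‖a - b‖ - ‖b - c‖) ^ 2 / u =
      u * ‖a - b‖ ^ 2 + 1 / u * ‖b - c‖ ^ 2 - 2 * (‖a - b‖ * ‖b - c‖) := by
    field_simp; ring
  linarith

theorem recursion_of_step {γ η ε ρ κ D a e e' Δ : ℝ} (hγ : 0 < γ) (hη : 0 < η) (hε : 0 < ε)
    (hερ : ε ≤ ρ) (hu : η * γ ≤ 1 / 2) (hD : 0 ≤ D) (ha : 0 ≤ a) (hΔ : 0 ≤ Δ)
    (hstep : e' ≤ (1 - 2 * (η * γ)) * e + γ ^ 2 * D)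
    (hshift : e ≤ (1 + η * γ) * a + (1 + 1 / (η * γ)) * Δ)
    (hvar : Δ ≤ κ * (η * γ ^ 3 / ε ^ 2)) :
    e' ≤ (1 - η * γ) * a + η * γ * ((κ + ρ ^ 2 * D) * (γ / (η * ε ^ 2))) := by
  have hv : 0 < η * γ := mul_pos hη hγ
  have hq : 0 < γ / (η * ε ^ 2) := by positivity
  have e1 : η * γ ^ 3 / ε ^ 2 = η * γ * (η * γ * (γ / (η * ε ^ 2))) := by field_simp
  have e2 : γ ^ 2 = η * γ * (ε ^ 2 * (γ / (η * ε ^ 2))) := by field_simp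
  rw [e1] at hvar
  rw [e2] at hstep
  -- With v = ηγ the drift is at most κ v² q and γ² equals v ε² q, so each error is v times O(q)
  -- once the drift is divided by v.
  generalize γ / (η * ε ^ 2) = q at *
  generalize η * γ = v at *
  have h3 : v * (ε ^ 2 * q) * D ≤ v * (ρ ^ 2 * D * q) := by
    have h := pow_le_pow_left₀ hε.le hερ 2
    calc v * (ε ^ 2 * q) * D = v * (ε ^ 2 * D * q) := by ring
      _ ≤ _ := by gcongr
  have h4 : Δ / v ≤ v * (κ * q) := by
    rw [div_le_iff₀ hv]
    exact hvar.trans_eq (by ring)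
  have h5 : (1 - 2 * v) * ((1 + v) * a + (1 + 1 / v) * Δ) ≤ (1 - v) * a + Δ / v := by
    have e : (1 - 2 * v) * ((1 + v) * a + (1 + 1 / v) * Δ) =
        (1 - v) * a + Δ / v - 2 * v ^ 2 * a - (1 + 2 * v) * Δ := by field_simp; ring
    rw [e]
    have : 0 ≤ 2 * v ^ 2 * a := by positivity
    have : 0 ≤ (1 + 2 * v) * Δ := by positivity
    linarith
  have h6 := mul_le_mul_of_nonneg_left hshift (by linarith : 0 ≤ 1 - 2 * v)
  linarith

/-- The iterates approach the trajectory of regularized solutions in mean square. -/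
theorem tendsto_integral_norm_sub_trajectory (hΦ : Measurable (Function.uncurry Φ))
    (hp : ProblemProperties P X Φ ξ ρ C) (hr : RandomInputs P ξ ξs z (x 0) ε)
    (ht : TuningSequences n C ρ γ η ε) (hms : MeanSquareSequences γ η ε)
    (hratio : Tendsto (fun k => γ k / (η k * ε k ^ 2)) atTop (𝓝 0))
    (hx : IsRSSA X Φ γ η ξs z x) {M R : ℝ}
    (hM : ∀ v ∈ enlargement X ρ, ‖expMap P Φ ξ v‖ ≤ M) (hM0 : 0 ≤ M) (hR : ∀ v ∈ X, ‖v‖ ≤ R)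
    {s : ℕ → Vec n}
    (hs : ∀ k, s k ∈ SOL X fun v => smoothing (expMap P Φ ξ) (ε k) v + η k • v) :
    Tendsto (fun k => ∫ ω, ‖x (k + 1) ω - s k‖ ^ 2 ∂P) atTop (𝓝 0) := by
  have hγ := ht.γ_pos
  have hη := ht.η_pos
  have hε := ht.ε_pos
  have hne : X.Nonempty := hp.solution.mono fun v hv => hv.1
  have hmeas := hx.measurable hp.isClosed hp.convex hne hΦ hr
  set u : ℕ → ℝ := fun k => η k * γ k
  set q : ℕ → ℝ := fun k => γ k / (η k * ε k ^ 2)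
  have hu : ∀ k, 0 < u k := fun k => mul_pos (hη k) (hγ k)
  have hu_lim : Tendsto u atTop (𝓝 0) := by simpa using ht.η_tendsto.mul ht.γ_tendsto
  have hq : ∀ k, 0 < q k := fun k => div_pos (hγ k) (mul_pos (hη k) (pow_pos (hε k) 2))
  -- The growth condition limits the decay of q by u, and q tends to 0.
  have hnsum : ¬ Summable u := by
    obtain ⟨δ, hδ, -, K, hK⟩ := hms.growth
    refine not_summable_of_le_mul_one_add hδ.le hq (fun k => (hu k).le) hratio (K := K)
      fun k hk => ?_
    rw [← mul_assoc]
    exact hK k hk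
  obtain ⟨B₁, -, hB₁⟩ := hms.ε_variation
  obtain ⟨B₂, -, hB₂⟩ := hms.η_variation
  set κ := 2 * (2 * M * n) ^ 2 * B₁ + 2 * R ^ 2 * B₂
  set D := 2 * C ^ 2 + 2 * R ^ 2
  have hD : 0 ≤ D := by positivity
  -- The recursion from k to k + 1 uses the step with parameters of index k + 1, whence the shifts
  -- in u and b.
  refine tendsto_zero_of_le_one_sub_mul_add (u := fun k => u (k + 1))
    (b := fun k => (κ + ρ ^ 2 * D) * q (k + 1)) (fun k => integral_nonneg fun ω => by positivity)
    (fun k => (hu _).le) ?_ ?_ ?_ ?_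
  · exact (tendsto_add_atTop_nat 1).eventually (hu_lim.eventually_le_const one_pos)
  · rwa [summable_nat_add_iff 1]
  · simpa using (hratio.comp (tendsto_add_atTop_nat 1)).const_mul (κ + ρ ^ 2 * D)
  filter_upwards [(tendsto_add_atTop_nat 1).eventually
    (hu_lim.eventually_le_const (half_pos one_pos)),
    (tendsto_add_atTop_nat 1).eventually (ht.η_tendsto.eventually_le_const one_pos)] with k h1 h2
  have hstep := hp.integral_step_le hΦ hr.measurable_ξ (hε (k + 1)) (ht.ε_le (k + 1))
    (hmeas (k + 1)) (hr.measurable_z (k + 1)) (hr.measurable_ξs (k + 1)) (hx.mem (k + 1))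
    (hx.map_inputs hp.isClosed hp.convex hne hΦ hr (k + 1)) hR (hγ (k + 1)).le (hη (k + 1)).le h2
    (hs (k + 1)) (hmeas (k + 1 + 1)) (hx.step (k + 1))
  have hvar := norm_sub_sq_le_of_variation hp.continuous hp.monotone hM hM0 hR (hε k)
    (hε (k + 1)) (ht.ε_le k) (ht.ε_le (k + 1)) (hη k) (hη (k + 1)) (hγ (k + 1)) (hB₁ k) (hB₂ k)
    (hs k) (hs (k + 1))
  have i1 := integrable_norm_sub_sq_of_mem (P := P) hR (hmeas (k + 1)) (hx.mem _) (hs k).1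
  have i2 := integrable_norm_sub_sq_of_mem (P := P) hR (hmeas (k + 1)) (hx.mem _) (hs (k + 1)).1
  set v := u (k + 1)
  have hv : 0 < v := hu (k + 1)
  set a := ∫ ω, ‖x (k + 1) ω - s k‖ ^ 2 ∂P
  have ha : 0 ≤ a := integral_nonneg fun ω => by positivity
  set Δ := ‖s k - s (k + 1)‖ ^ 2
  have hΔ : 0 ≤ Δ := by positivity
  have hshift : ∫ ω, ‖x (k + 1) ω - s (k + 1)‖ ^ 2 ∂P ≤ (1 + v) * a + (1 + 1 / v) * Δ := by
    refine (integral_mono i2 ((i1.const_mul (1 + v)).add (integrable_const ((1 + 1 / v) * Δ)))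
      fun ω => norm_sub_sq_le_weighted _ (s k) _ hv).trans_eq ?_
    simp only [Pi.add_apply]
    rw [integral_add (i1.const_mul _) (integrable_const _), integral_const_mul, integral_const]
    simp [a]
  exact recursion_of_step (hγ (k + 1)) (hη (k + 1)) (hε (k + 1)) (ht.ε_le (k + 1)) h1 hD ha hΔ
    hstep hshift hvar

end

end RSSA

/-! ### Transfer from the trajectory to the solution set -/

theorem mainTheorem4 {n d : ℕ} (hn : 1 ≤ n) {Ω : Type*} [MeasurableSpace Ω]
    (P : Measure Ω) [IsProbabilityMeasure P]
    (X : Set (Vec n)) (Φ : Vec n → Vec d → Vec n) (hΦ : Measurable (Function.uncurry Φ))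
    (ξ : Ω → Vec d) (ξs : ℕ → Ω → Vec d) (z : ℕ → Ω → Vec n) (x : ℕ → Ω → Vec n)
    (γ η ε : ℕ → ℝ) (ρ C : ℝ)
    (hproblem : RSSA.ProblemProperties P X Φ ξ ρ C)
    (hrandom : RSSA.RandomInputs P ξ ξs z (x 0) ε)
    (htuning : RSSA.TuningSequences n C ρ γ η ε)
    (hms : RSSA.MeanSquareSequences γ η ε)
    (hratio : Tendsto (fun k => γ k / (η k * ε k ^ 2)) atTop (𝓝 0))
    (hx : RSSA.IsRSSA X Φ γ η ξs z x) :
    ((∀ k, Integrable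
        (fun ω => Metric.infDist (x k ω) (RSSA.SOL X (RSSA.expMap P Φ ξ)) ^ 2) P) ∧
      Tendsto (fun k => ∫ ω, Metric.infDist (x k ω) (RSSA.SOL X (RSSA.expMap P Φ ξ)) ^ 2 ∂P)
        atTop (𝓝 0)) ∧
    (∀ t : Vec n, RSSA.IsLeastNormSolution X (RSSA.expMap P Φ ξ) t →
      Tendsto (fun k => ε k / η k) atTop (𝓝 0) →
      RSSA.BoundedJacobianNear (RSSA.expMap P Φ ξ) t →
      (∀ k, Integrable (fun ω => ‖x k ω - t‖ ^ 2) P) ∧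
        Tendsto (fun k => ∫ ω, ‖x k ω - t‖ ^ 2 ∂P) atTop (𝓝 0)) := by
  have hcpt : IsCompact X := Metric.isCompact_of_isClosed_isBounded hproblem.isClosed
    hproblem.isBounded
  have hne : X.Nonempty := hproblem.solution.mono fun v hv => hv.1
  obtain ⟨M, hM⟩ := (RSSA.isCompact_enlargement (ρ := ρ) hcpt).exists_bound_of_continuousOn
    hproblem.continuous
  obtain ⟨R, hR⟩ := hproblem.isBounded.exists_norm_le
  have hM0 : 0 ≤ M := by
    obtain ⟨v, hv⟩ := hne
    exact (norm_nonneg _).trans (hM v (RSSA.subset_enlargement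
      ((htuning.ε_pos 0).le.trans (htuning.ε_le 0)) hv))
  choose s hs using fun k => RSSA.SOL_smoothing_add_smul_nonempty hn hproblem.isClosed
    hproblem.convex hne hproblem.continuous hproblem.monotone hM hM0 (htuning.ε_pos k)
    (htuning.ε_le k) (htuning.η_pos k)
  have hmeas := hx.measurable hproblem.isClosed hproblem.convex hne hΦ hrandom
  have htraj := RSSA.tendsto_integral_norm_sub_trajectory hΦ hproblem hrandom htuning hms hratio hx
    hM hM0 hR hs
  have hint := fun k => RSSA.integrable_norm_sub_sq_of_mem (P := P) hR (hmeas (k + 1))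
    (hx.mem (k + 1)) (hs k).1
  -- For f nonnegative and 1-Lipschitz, f(x)² ≤ 2‖x - s‖² + 2 f(s)². It is applied to the distance
  -- to the solution set and to the distance to t.
  have transfer : ∀ f : Vec n → ℝ, (∀ v, 0 ≤ f v) → (∀ v w, f v ≤ ‖v - w‖ + f w) →
      (∀ k, Integrable (fun ω => f (x k ω) ^ 2) P) →
      Tendsto (fun k => f (s k)) atTop (𝓝 0) →
      Tendsto (fun k => ∫ ω, f (x k ω) ^ 2 ∂P) atTop (𝓝 0) := by
    intro f hf0 hf hfi hlim
    -- The trajectory estimate pairs x (k + 1) with s k.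
    rw [← tendsto_add_atTop_iff_nat 1]
    have hbound := (htraj.const_mul 2).add ((hlim.pow 2).const_mul 2)
    simp only [mul_zero, add_zero, zero_pow two_ne_zero] at hbound
    refine squeeze_zero (fun k => integral_nonneg fun ω => by positivity) (fun k => ?_) hbound
    refine (integral_mono (hfi (k + 1))
      (((hint k).const_mul 2).add (integrable_const (2 * f (s k) ^ 2))) fun ω => ?_).trans_eq ?_
    · exact (pow_le_pow_left₀ (hf0 _) (hf _ (s k)) 2).trans (add_sq_le.trans_eq (mul_add _ _ _))
    · simp only [Pi.add_apply]
      rw [integral_add ((hint k).const_mul _) (integrable_const _), integral_const_mul,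
        integral_const]
      simp
  refine ⟨?_, fun t ht hεη hJ => ?_⟩
  · have hfi : ∀ k, Integrable
        (fun ω => Metric.infDist (x k ω) (RSSA.SOL X (RSSA.expMap P Φ ξ)) ^ 2) P := by
      intro k
      obtain ⟨t, ht⟩ := hproblem.solution
      refine (RSSA.integrable_norm_sub_sq_of_mem (P := P) hR (hmeas k) (hx.mem k) ht.1).mono'
        (((Metric.continuous_infDist_pt _).measurable.comp (hmeas k)).pow_const 2
          |>.aestronglyMeasurable) (Eventually.of_forall fun ω => ?_)
      rw [Real.norm_of_nonneg (sq_nonneg _), ← dist_eq_norm]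
      exact pow_le_pow_left₀ Metric.infDist_nonneg (Metric.infDist_le_dist_of_mem ht) 2
    refine ⟨hfi, transfer (fun v => Metric.infDist v (RSSA.SOL X (RSSA.expMap P Φ ξ)))
      (fun v => Metric.infDist_nonneg) (fun v w => ?_) hfi
      (RSSA.tendsto_infDist_SOL hcpt hproblem.continuous htuning.ε_pos htuning.ε_le
        htuning.ε_tendsto htuning.η_tendsto hs)⟩
    rw [← dist_eq_norm, add_comm]
    exact Metric.infDist_le_infDist_add_dist
  · have hfi := fun k => RSSA.integrable_norm_sub_sq_of_mem (P := P) hR (hmeas k) (hx.mem k)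
      ht.1.1
    exact ⟨hfi, transfer (fun v => ‖v - t‖) (fun v => norm_nonneg _)
      (fun v w => norm_sub_le_norm_sub_add_norm_sub _ _ _) hfi
      (RSSA.tendsto_norm_sub_leastNorm hcpt hproblem.continuous hproblem.monotone htuning.ε_pos
        htuning.ε_le htuning.ε_tendsto htuning.η_pos htuning.η_tendsto hs ht hεη hJ)⟩
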